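/- Let $C\subset\mathbb{R}^n$ be a convex polyhedral cone (generated by finitely many vectors) that is pointed, i.e. contains no line, and let $\dim C$ be the dimension of its linear span. Let $V(C)$ be the set of unit vectors spanning the vertex rays (one-dimensional faces) of $C$, and let $f(C)$ be the set of facets (faces of dimension $\dim C-1$) of $C$. For $F\in f(C)$ let $n_F$ be the unit normal of $F$ that lies in the linear span of $C$ and points into $C$. A *triangulation* of $C$ (without new vertices) is a finite collection $T$ of simplicial cones of dimension $\dim C$ such that $\bigcup_{S\in T}S=C$, each intersection $S\cap S'$ of cones in $T$ is a face of both $S$ and $S'$, and $V(S)\subseteq V(C)$ for all $S\in T$. For such $T$ define the polynomial in $x=(x_1,\dots,x_n)$ $$\operatorname{adj}_{C,T}(x)=\sum_{S\in T}a_S\prod_{v\in V(C)\setminus V(S)}(v\cdot x),$$ where $a_S$ is the $(\dim S)$-dimensional volume of the parallelepiped spanned by $V(S)$. **Corollary 2.4 (independence of triangulation).** 1. For any two triangulations $T,T'$ of $C$, $\operatorname{adj}_{C,T}=\operatorname{adj}_{C,T'}$. So one may write $\operatorname{adj}_C$. 2. (Facet recursion.) For any triangulation $T$ of $C$, any triangulations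 $T_F$ of the facets $F\in f(C)$, and any $u$ in the linear span of $C$, $$(u\cdot x)\operatorname{adj}_{C,T}(x)=\sum_{F\in f(C)}(u\cdot n_F)\operatorname{adj}_{F,T_F}(x)\prod_{v\in V(C)\setminus V(F)}(v\cdot x).$$ 3. If $\dim C=2$, then $\{C\}$ is a triangulation of $C$, and it is the only one. -/

import Mathlib

open scoped MeasureTheory

namespace ConeAdjoint

/-- Euclidean space `ℝⁿ` with its standard inner product. -/
abbrev E (n : ℕ) : Type := EuclideanSpace ℝ (Fin n)

variable {n : ℕ}

/-- The dimension of a cone: the dimension of its linear span. -/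
noncomputable def dim (C : PointedCone ℝ (E n)) : ℕ :=
  Module.finrank ℝ (Submodule.span ℝ (C : Set (E n)))

/-- The unit vectors spanning the vertex rays (one-dimensional faces, extreme rays) of `C`. -/
def vertexSet (C : PointedCone ℝ (E n)) : Set (E n) :=
  {v | ‖v‖ = 1 ∧ (PointedCone.hull ℝ {v}).IsFaceOf C}

/-- `F` is a facet of `C`: a face of codimension one. -/
def IsFacet (C F : PointedCone ℝ (E n)) : Prop :=
  F.IsFaceOf C ∧ dim F + 1 = dim C

/-- A face of the cone generated by `s` is generated by the elements of `s` it contains. -/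
theorem face_eq_hull {s : Set (E n)} {F : PointedCone ℝ (E n)}
    (hF : F.IsFaceOf (PointedCone.hull ℝ s)) : F = PointedCone.hull ℝ (s ∩ F) := by
  apply le_antisymm
  · suffices h : ∀ x ∈ PointedCone.hull ℝ s, x ∈ F → x ∈ PointedCone.hull ℝ (s ∩ F) from
      fun x hx => h x (hF.le hx) hx
    intro x hx
    induction hx using Submodule.span_induction with
    | mem x h => exact fun hxF => Submodule.subset_span ⟨h, hxF⟩
    | zero => exact fun _ => Submodule.zero_mem _
    | add x y hx hy ihx ihy =>
      intro h
      exact Submodule.add_mem _ (ihx (hF.mem_of_add_mem_left hx hy h))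
        (ihy (hF.mem_of_add_mem_right hx hy h))
    | smul a x hx ih =>
      intro h
      rcases eq_or_ne a 0 with rfl | ha
      · simp
      · refine Submodule.smul_mem _ a (ih ?_)
        have := Submodule.smul_mem F a⁻¹ h
        rwa [smul_smul, inv_mul_cancel₀ ha, one_smul] at this
  · exact Submodule.span_le.2 fun x hx => hx.2

/-- A polyhedral cone has finitely many faces. -/
theorem finite_faces {C : PointedCone ℝ (E n)} (hC : C.FG) :
    {F : PointedCone ℝ (E n) | F.IsFaceOf C}.Finite := by
  obtain ⟨s, rfl⟩ := hC
  refine (s.finite_toSet.finite_subsets.image (PointedCone.hull ℝ)).subset fun F hF => ?_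
  exact ⟨(s : Set (E n)) ∩ F, Set.inter_subset_left, (face_eq_hull hF).symm⟩

theorem finite_vertexSet {C : PointedCone ℝ (E n)} (hC : C.FG) : (vertexSet C).Finite := by
  refine Set.Finite.of_finite_image (f := fun v => PointedCone.hull ℝ {v})
    ((finite_faces hC).subset ?_) ?_
  · rintro _ ⟨v, hv, rfl⟩
    exact hv.2
  · intro v hv w hw h
    have h' : PointedCone.hull ℝ {v} = PointedCone.hull ℝ {w} := h
    have hvw : v ∈ PointedCone.hull ℝ {w} := h' ▸ Submodule.mem_span_singleton_self v
    obtain ⟨a, rfl⟩ := Submodule.mem_span_singleton.1 hvw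
    have h1 : ‖a • w‖ = 1 := hv.1
    have h2 : ‖w‖ = 1 := hw.1
    have h3 : (a : ℝ) = 1 := by
      change ‖(a : ℝ) • w‖ = 1 at h1
      rwa [norm_smul, h2, mul_one, Real.norm_of_nonneg a.2] at h1
    change (a : ℝ) • w = w
    rw [h3, one_smul]

open Classical in
/-- `V(C)` as a finite set; the default value `∅` is never used for polyhedral cones,
see `mem_vertices`. -/
noncomputable def vertices (C : PointedCone ℝ (E n)) : Finset (E n) :=
  if h : (vertexSet C).Finite then h.toFinset else ∅

theorem mem_vertices {C : PointedCone ℝ (E n)} (hC : C.FG) {v : E n} :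
    v ∈ vertices C ↔ ‖v‖ = 1 ∧ (PointedCone.hull ℝ {v}).IsFaceOf C := by
  rw [vertices, dif_pos (finite_vertexSet hC), Set.Finite.mem_toFinset]
  rfl

open Classical in
/-- The facets of `C` as a finite set; the default value `∅` is never used for polyhedral cones,
see `mem_facets`. -/
noncomputable def facets (C : PointedCone ℝ (E n)) : Finset (PointedCone ℝ (E n)) :=
  if h : {F | IsFacet C F}.Finite then h.toFinset else ∅

theorem mem_facets {C : PointedCone ℝ (E n)} (hC : C.FG) {F : PointedCone ℝ (E n)} :
    F ∈ facets C ↔ IsFacet C F := by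
  have h : {F | IsFacet C F}.Finite := (finite_faces hC).subset fun F hF => hF.1
  rw [facets, dif_pos h, Set.Finite.mem_toFinset]
  rfl

/-- `u` is a unit normal vector of `F` inside the linear span of `C`, pointing into `C`. -/
def IsInwardUnitNormal (C F : PointedCone ℝ (E n)) (u : E n) : Prop :=
  u ∈ Submodule.span ℝ (C : Set (E n)) ∧ ‖u‖ = 1 ∧
    (∀ y ∈ F, inner ℝ u y = 0) ∧ ∀ y ∈ C, 0 ≤ inner ℝ u y

open Classical in
/-- The inward pointing unit normal `n_F` of a facet `F` of `C`; it exists and is unique,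
see `existsUnique_isInwardUnitNormal`. -/
noncomputable def inwardNormal (C F : PointedCone ℝ (E n)) : E n :=
  if h : ∃ u, IsInwardUnitNormal C F u then h.choose else 0

/-- `T` is a triangulation of `C` without new vertices. -/
structure IsTriangulation (C : PointedCone ℝ (E n)) (T : Finset (PointedCone ℝ (E n))) :
    Prop where
  simplicial : ∀ S ∈ T, S.IsSimplicial
  dim_eq : ∀ S ∈ T, dim S = dim C
  iUnion_eq : ⋃ S ∈ T, (S : Set (E n)) = C
  inter_face : ∀ S ∈ T, ∀ S' ∈ T, (S ⊓ S').IsFaceOf S ∧ (S ⊓ S').IsFaceOf S'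
  vertices_subset : ∀ S ∈ T, vertices S ⊆ vertices C

/-- `a_S`: the `dim S`-dimensional Euclidean volume of the parallelepiped spanned by the unit
vertex vectors of `S`. -/
noncomputable def paraVol (S : PointedCone ℝ (E n)) : ℝ :=
  (μHE[dim S] : MeasureTheory.Measure (E n)).real
    (parallelepiped fun v : vertices S => (v : E n))

/-- The linear form `v · x` as a polynomial in the coordinates of `x`. -/
noncomputable def linForm (v : E n) : MvPolynomial (Fin n) ℝ :=
  ∑ i, MvPolynomial.C (v i) * MvPolynomial.X i

open Classical in
/-- The adjoint polynomial of `C` computed from the triangulation `T`: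
`∑_{S ∈ T} a_S ∏_{v ∈ V(C) \ V(S)} (v · x)`. -/
noncomputable def adj (C : PointedCone ℝ (E n)) (T : Finset (PointedCone ℝ (E n))) :
    MvPolynomial (Fin n) ℝ :=
  ∑ S ∈ T, MvPolynomial.C (paraVol S) * ∏ v ∈ vertices C \ vertices S, linForm v

open Classical in
/-- The right-hand side of the facet recursion for the linear form `u · x`, where `τ F` is a
triangulation of the facet `F`:
`∑_{F ∈ f(C)} (u · n_F) adj_F(x) ∏_{v ∈ V(C) \ V(F)} (v · x)`. -/
noncomputable def facetSum (C : PointedCone ℝ (E n))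
    (τ : PointedCone ℝ (E n) → Finset (PointedCone ℝ (E n))) (u : E n) :
    MvPolynomial (Fin n) ℝ :=
  ∑ F ∈ facets C, MvPolynomial.C (inner ℝ u (inwardNormal C F)) * adj F (τ F) *
    ∏ v ∈ vertices C \ vertices F, linForm v

/-- Every facet has exactly one inward pointing unit normal. -/
theorem existsUnique_isInwardUnitNormal {C F : PointedCone ℝ (E n)} (hF : IsFacet C F) :
    ∃! u, IsInwardUnitNormal C F u := by
  obtain ⟨hface, hdim⟩ := hF
  set A := Submodule.span ℝ (C : Set (E n)) with hA
  set B := Submodule.span ℝ (F : Set (E n)) with hB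
  have hBA : B ≤ A := Submodule.span_mono hface.le
  have hfin : Module.finrank ℝ ↥(Bᗮ ⊓ A) = 1 := by
    have := Submodule.finrank_add_inf_finrank_orthogonal hBA
    have hdim2 : Module.finrank ℝ B + 1 = Module.finrank ℝ A := hdim
    omega
  obtain ⟨⟨w₀, hw₀⟩, hne, hspan⟩ := finrank_eq_one_iff'.1 hfin
  have hw₀ne : w₀ ≠ 0 := fun h => hne (Subtype.ext h)
  have hmul : ∀ x ∈ Bᗮ ⊓ A, ∃ c : ℝ, x = c • w₀ := fun x hx => by
    obtain ⟨c, hc⟩ := hspan ⟨x, hx⟩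
    exact ⟨c, (congrArg Subtype.val hc).symm⟩
  have hpos : 0 < inner ℝ w₀ w₀ := real_inner_self_pos.2 hw₀ne
  -- differences of elements of `F` exhaust `B`
  have hdiff : ∀ x ∈ B, ∃ f ∈ F, x + f ∈ F := by
    intro x hx
    induction hx using Submodule.span_induction with
    | mem x h => exact ⟨0, F.zero_mem, by simpa using h⟩
    | zero => exact ⟨0, F.zero_mem, by simp⟩
    | add x y _ _ ihx ihy =>
      obtain ⟨f, hf, hf'⟩ := ihx
      obtain ⟨g, hg, hg'⟩ := ihy
      refine ⟨f + g, F.add_mem hf hg, ?_⟩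
      have := F.add_mem hf' hg'
      rwa [add_add_add_comm] at this
    | smul a x _ ih =>
      obtain ⟨f, hf, hf'⟩ := ih
      rcases le_total 0 a with ha | ha
      · refine ⟨a • f, F.smul_mem ha hf, ?_⟩
        have : a • (x + f) ∈ F := F.smul_mem ha hf'
        rwa [smul_add] at this
      · have ha' : 0 ≤ -a := neg_nonneg.2 ha
        refine ⟨(-a) • (x + f), F.smul_mem ha' hf', ?_⟩
        have : (-a) • f ∈ F := F.smul_mem ha' hf
        convert this using 1
        module
  -- points of `A` orthogonal to `w₀` lie in `B`
  have hker : ∀ x ∈ A, inner ℝ w₀ x = 0 → x ∈ B := by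
    intro x hx h0
    obtain ⟨y, hy, z, hz, rfl⟩ := B.exists_add_mem_mem_orthogonal x
    have hzA : z ∈ A := by
      have := A.sub_mem hx (hBA hy)
      rwa [add_sub_cancel_left] at this
    obtain ⟨c, rfl⟩ := hmul z ⟨hz, hzA⟩
    have hwy : inner ℝ w₀ y = 0 := Submodule.inner_left_of_mem_orthogonal hy hw₀.1
    rw [inner_add_right, hwy, inner_smul_right, zero_add] at h0
    rcases mul_eq_zero.1 h0 with hc | hc
    · simpa [hc] using hy
    · exact absurd hc hpos.ne'
  have hsign : ∀ y ∈ C, ∀ z ∈ C, 0 < inner ℝ w₀ y → inner ℝ w₀ z < 0 → False := by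
    intro y hy z hz hy0 hz0
    set a : ℝ := -inner ℝ w₀ z with ha
    set b : ℝ := inner ℝ w₀ y with hb
    have ha0 : 0 < a := by linarith
    have hayC : a • y ∈ C := C.smul_mem ha0.le hy
    have hbzC : b • z ∈ C := C.smul_mem hy0.le hz
    have hmem : a • y + b • z ∈ B := by
      refine hker _ (A.add_mem (Submodule.subset_span hayC) (Submodule.subset_span hbzC)) ?_
      rw [inner_add_right, inner_smul_right, inner_smul_right, ← hb, ha]
      ring
    obtain ⟨f, hf, hf'⟩ := hdiff _ hmem
    rw [add_assoc] at hf'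
    have hyF : y ∈ F :=
      hface.mem_of_smul_add_mem hy (C.add_mem hbzC (hface.le hf)) ha0 hf'
    have : inner ℝ w₀ y = 0 :=
      Submodule.inner_left_of_mem_orthogonal (Submodule.subset_span hyF) hw₀.1
    linarith
  obtain ⟨w, hw, hwne, hwC⟩ : ∃ w ∈ Bᗮ ⊓ A, w ≠ 0 ∧ ∀ y ∈ C, 0 ≤ inner ℝ w y := by
    by_cases h : ∃ y ∈ C, 0 < inner ℝ w₀ y
    · obtain ⟨y, hy, hy0⟩ := h
      exact ⟨w₀, hw₀, hw₀ne, fun z hz => not_lt.1 fun hz0 => hsign y hy z hz hy0 hz0⟩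
    · push Not at h
      refine ⟨-w₀, Submodule.neg_mem _ hw₀, neg_ne_zero.2 hw₀ne, fun z hz => ?_⟩
      rw [inner_neg_left]
      linarith [h z hz]
  have hwn : 0 < ‖w‖ := norm_pos_iff.2 hwne
  have hu : IsInwardUnitNormal C F (‖w‖⁻¹ • w) := by
    refine ⟨Submodule.smul_mem _ _ hw.2, ?_, fun y hy => ?_, fun y hy => ?_⟩
    · rw [norm_smul, norm_inv, norm_norm, inv_mul_cancel₀ hwn.ne']
    · have : inner ℝ w y = 0 :=
        Submodule.inner_left_of_mem_orthogonal (Submodule.subset_span hy) hw.1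
      simp [inner_smul_left, this]
    · rw [real_inner_smul_left]
      exact mul_nonneg (inv_nonneg.2 hwn.le) (hwC y hy)
  refine ⟨_, hu, ?_⟩
  have horth : ∀ v, IsInwardUnitNormal C F v → v ∈ Bᗮ ⊓ A := by
    intro v hv
    refine ⟨(Submodule.mem_orthogonal' _ _).2 fun x hx => ?_, hv.1⟩
    obtain ⟨f, hf, hf'⟩ := hdiff x hx
    have h1 := hv.2.2.1 _ hf'
    rw [inner_add_right, hv.2.2.1 f hf, add_zero] at h1
    exact h1
  have key : ∀ u v, IsInwardUnitNormal C F u → IsInwardUnitNormal C F v → u = v := by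
    intro u v hu hv
    obtain ⟨c, hc⟩ := hmul u (horth u hu)
    obtain ⟨d, hd⟩ := hmul v (horth v hv)
    have hd0 : d ≠ 0 := by
      rintro rfl
      have := hv.2.1
      simp [hd] at this
    have huv : u = (c / d) • v := by
      rw [hc, hd, smul_smul, div_mul_cancel₀ _ hd0]
    have habs : |c / d| = 1 := by
      have := hu.2.1
      rwa [huv, norm_smul, hv.2.1, mul_one, Real.norm_eq_abs] at this
    rcases (abs_eq zero_le_one).1 habs with h | h
    · rw [huv, h, one_smul]
    · exfalso
      rw [h, neg_one_smul] at huv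
      have hz : ∀ y ∈ A, inner ℝ v y = 0 := by
        intro y hy
        induction hy using Submodule.span_induction with
        | mem y hy =>
          have h1 := hu.2.2.2 y hy
          rw [huv, inner_neg_left] at h1
          linarith [hv.2.2.2 y hy]
        | zero => simp
        | add x y _ _ hx hy => rw [inner_add_right, hx, hy, add_zero]
        | smul a x _ hx => rw [inner_smul_right, hx, mul_zero]
      have hv0 := hz v hv.1
      rw [inner_self_eq_zero] at hv0
      have := hv.2.1
      simp [hv0] at this
  exact fun v hv => key v _ hv hu

theorem inwardNormal_spec {C F : PointedCone ℝ (E n)} (hF : IsFacet C F) :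
    IsInwardUnitNormal C F (inwardNormal C F) := by
  have h := (existsUnique_isInwardUnitNormal hF).exists
  rw [inwardNormal, dif_pos h]
  exact h.choose_spec

end ConeAdjoint

/-! The heart is the facet recursion for a single simplicial cone `S`. Writing `u` in the basis
`V(S)`, the coefficient of `v` is `(u · n_v) / (v · n_v)`, where `n_v` is the inward normal of the
facet opposite `v`, and base times height gives `a_S = (v · n_v) a_{S_v}` for that facet `S_v`.
Hence `(u · x) a_S = ∑ (u · n_v) a_{S_v} (v · x)` (`linForm_mul_paraVol`).

Multiply by the product over `V(C) \ V(S)` and sum over a triangulation. The factor `v · x`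
completes the product to one over `V(C) \ V(S_v)`, so each term depends only on the facet `S_v` and
on its oriented normal. An interior facet is shared by two cones with opposite normals, and these
terms cancel (`exists_opposite`, `eq_of_oppFacet_eq`, `sum_interior_eq_zero`). The boundary facets,
grouped by the facet of `C` containing them, form the induced triangulations
(`isTriangulation_trace`). This is the recursion for induced triangulations, `linForm_mul_adj`.

Independence follows by induction on the dimension: for `u ≠ 0` the right-hand sides agree by
induction, and `u · x` cancels (`adj_eq_adj`). Independence in turn allows arbitrary triangulations
of the facets.

In dimension two, signs in linear relations between irredundant generators show that `C` is itself
simplicial, and counting vertices leaves no other triangulation. -/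

/-! ### Volumes of parallelepipeds and Gram determinants -/

/-- The Euclidean Hausdorff measure of a parallelepiped in terms of the Gram determinant. -/
theorem euclideanHausdorffMeasure_parallelepiped {ι V : Type*} [Fintype ι] [DecidableEq ι]
    [NormedAddCommGroup V] [InnerProductSpace ℝ V] [MeasurableSpace V] [BorelSpace V]
    (v : ι → V) :
    (μHE[Fintype.card ι] : MeasureTheory.Measure V) (parallelepiped v) =
      ENNReal.ofReal (Real.sqrt (Matrix.gram ℝ v).det) := by
  set b := EuclideanSpace.basisFun ι ℝ
  -- `f` carries the unit cube to the parallelepiped, so the volume is the scaling factor `normDet`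
  -- of `f`.
  set f : EuclideanSpace ℝ ι →ₗ[ℝ] V := b.toBasis.constr ℝ v with hf
  have hfb : ∀ i, f (b i) = v i := fun i => by
    rw [hf, ← b.coe_toBasis, Module.Basis.constr_basis]
  have himage : parallelepiped v = f '' parallelepiped b := by
    rw [image_parallelepiped]
    exact congrArg _ (funext fun i => (hfb i).symm)
  have hdet : f.normDet = Real.sqrt (Matrix.gram ℝ v).det := by
    have h := f.normDet_sq_eq_det_gram b
    simp only [hfb] at h
    rw [← show f.normDet ^ 2 = (Matrix.gram ℝ v).det from h, Real.sqrt_sq f.normDet_nonneg]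
  have h := f.euclideanHausdorffMeasure_image_eq_normDet_mul_volume (parallelepiped b)
  rwa [finrank_euclideanSpace, ← himage, hdet, b.volume_parallelepiped, mul_one] at h

theorem gram_sum_smul {ι κ V : Type*} [Fintype ι] [NormedAddCommGroup V]
    [InnerProductSpace ℝ V] (u : ι → V) (A : Matrix ι κ ℝ) :
    Matrix.gram ℝ (fun j => ∑ i, A i j • u i) = A.transpose * Matrix.gram ℝ u * A := by
  ext j k
  simp only [Matrix.gram_apply, Matrix.mul_apply, Matrix.transpose_apply, sum_inner, inner_sum,
    real_inner_smul_left, real_inner_smul_right, Finset.sum_mul]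
  refine Finset.sum_congr rfl fun i _ => Finset.sum_congr rfl fun l _ => ?_
  ring

/-- Base times height for Gram determinants. -/
theorem det_gram_sumElim {ι V : Type*} [Fintype ι] [DecidableEq ι] [NormedAddCommGroup V]
    [InnerProductSpace ℝ V] (u : ι → V) {m x : V} (hm : ‖m‖ = 1)
    (horth : ∀ i, inner ℝ m (u i) = 0)
    (hx : x - inner ℝ m x • m ∈ Submodule.span ℝ (Set.range u)) :
    (Matrix.gram ℝ (Sum.elim u fun _ : Unit => x)).det =
      inner ℝ m x ^ 2 * (Matrix.gram ℝ u).det := by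
  obtain ⟨w, hw⟩ := (Submodule.mem_span_range_iff_exists_fun ℝ).1 hx
  set c : ℝ := inner ℝ m x
  -- `A` is the change of family from `(u, m)` to `(u, x)`: its last column records `x = ∑ w i • u i
  -- + c • m`. The Gram matrix of `(u, m)` is block diagonal, and `det A = c` enters squared.
  set A : Matrix (ι ⊕ Unit) (ι ⊕ Unit) ℝ :=
    Matrix.fromBlocks 1 (Matrix.of fun i _ => w i) 0 (Matrix.of fun _ _ => c) with hA
  have hcomb : (Sum.elim u fun _ : Unit => x) =
      fun j => ∑ i, A i j • (Sum.elim u fun _ : Unit => m) i := by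
    funext j
    rcases j with j | j
    · simp [hA, Fintype.sum_sum_type, Matrix.one_apply]
    · simp [hA, Fintype.sum_sum_type, hw]
  have hblock : Matrix.gram ℝ (Sum.elim u fun _ : Unit => m) =
      Matrix.fromBlocks (Matrix.gram ℝ u) 0 0 1 := by
    ext i j
    rcases i with i | i <;> rcases j with j | j
    · simp
    · simpa [real_inner_comm] using horth i
    · simpa using horth j
    · simp [hm]
  have hdetA : A.det = c := by
    rw [hA, Matrix.det_fromBlocks_zero₂₁]
    simp
  rw [hcomb, gram_sum_smul, Matrix.det_mul, Matrix.det_mul, Matrix.det_transpose, hdetA, hblock,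
    Matrix.det_fromBlocks_zero₂₁]
  simp
  ring

/-- Base times height for the volume of the parallelepiped spanned by a finite set. -/
theorem euclideanHausdorffMeasure_real_parallelepiped_eq_mul {V : Type*} [NormedAddCommGroup V]
    [InnerProductSpace ℝ V] [MeasurableSpace V] [BorelSpace V] [DecidableEq V]
    {s : Finset V} {v m : V} (hv : v ∈ s)
    (hm : ‖m‖ = 1) (horth : ∀ w ∈ s.erase v, inner ℝ m w = 0) (hpos : 0 ≤ inner ℝ m v)
    (hx : v - inner ℝ m v • m ∈ Submodule.span ℝ (s.erase v : Set V)) :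
    (μHE[s.card] : MeasureTheory.Measure V).real (parallelepiped fun w : s => (w : V)) =
      inner ℝ m v * (μHE[(s.erase v).card] : MeasureTheory.Measure V).real
        (parallelepiped fun w : s.erase v => (w : V)) := by
  have hvol : ∀ t : Finset V, (μHE[t.card] : MeasureTheory.Measure V).real
      (parallelepiped fun w : t => (w : V)) =
        Real.sqrt (Matrix.gram ℝ fun w : t => (w : V)).det := fun t => by
    rw [MeasureTheory.measureReal_def, ← Fintype.card_coe t,
      euclideanHausdorffMeasure_parallelepiped, ENNReal.toReal_ofReal (Real.sqrt_nonneg _)]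
  rw [hvol (s.erase v)]
  set u : s.erase v → V := fun w => (w : V)
  have hrange : Set.range u = (s.erase v : Set V) := Subtype.range_coe
  set e : (s.erase v : Finset V) ⊕ Unit ≃ s := Equiv.ofBijective
    (Sum.elim (fun w => ⟨w, Finset.mem_of_mem_erase w.2⟩) fun _ => ⟨v, hv⟩) (by
      constructor
      · rintro (a | a) (b | b) h
        · have h' : (a : V) = b := congrArg (fun x : s => (x : V)) h
          exact congrArg Sum.inl (Subtype.ext h')
        · exact absurd (Subtype.ext_iff.1 h) (Finset.ne_of_mem_erase a.2)
        · exact absurd (Subtype.ext_iff.1 h).symm (Finset.ne_of_mem_erase b.2)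
        · rfl
      · rintro ⟨w, hw⟩
        by_cases h : w = v
        · exact ⟨Sum.inr (), Subtype.ext h.symm⟩
        · exact ⟨Sum.inl ⟨w, Finset.mem_erase.2 ⟨h, hw⟩⟩, rfl⟩) with he
  have hcomp : (fun w : s => (w : V)) ∘ e = Sum.elim u fun _ : Unit => v := by
    funext i
    rcases i with i | i <;> rfl
  have hcard : s.card = Fintype.card ((s.erase v : Finset V) ⊕ Unit) := by
    rw [Fintype.card_congr e, Fintype.card_coe]
  rw [← parallelepiped_comp_equiv (fun w : s => (w : V)) e, hcomp, MeasureTheory.measureReal_def,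
    hcard, euclideanHausdorffMeasure_parallelepiped,
    ENNReal.toReal_ofReal (Real.sqrt_nonneg _),
    det_gram_sumElim u hm (fun i => horth i i.2) (hrange ▸ hx),
    Real.sqrt_mul (sq_nonneg _), Real.sqrt_sq hpos]

namespace ConeAdjoint
variable {n : ℕ}

/-! ### Finitely generated cones: spans, dimensions, faces and vertices -/

theorem span_hull (s : Set (E n)) :
    Submodule.span ℝ (PointedCone.hull ℝ s : Set (E n)) = Submodule.span ℝ s :=
  Submodule.span_span_of_tower _ _ _

theorem mem_hull_finset {s : Finset (E n)} {x : E n} :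
    x ∈ PointedCone.hull ℝ (s : Set (E n)) ↔
      ∃ c : E n → ℝ, (∀ v, 0 ≤ c v) ∧ ∑ v ∈ s, c v • v = x := by
  constructor
  · intro hx
    obtain ⟨c, hc, h0, rfl⟩ := PointedCone.mem_hull_set.1 hx
    refine ⟨c, h0, ?_⟩
    rw [Finsupp.sum]
    refine (Finset.sum_subset (by exact_mod_cast hc) fun v _ hv => ?_).symm
    simp [Finsupp.notMem_support_iff.1 hv]
  · rintro ⟨c, h0, rfl⟩
    exact Submodule.sum_mem _ fun v hv =>
      PointedCone.smul_mem _ (h0 v) (Submodule.subset_span hv)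

theorem coeff_eq_of_linearIndepOn {s : Finset (E n)} (hs : LinearIndepOn ℝ id (s : Set (E n)))
    {c d : E n → ℝ} (h : ∑ v ∈ s, c v • v = ∑ v ∈ s, d v • v) {v : E n} (hv : v ∈ s) :
    c v = d v := by
  have h' := linearIndepOn_finset_iff.1 hs (fun v => c v - d v)
    (by simp [sub_smul, Finset.sum_sub_distrib, h]) v hv
  linarith

/-- Points of the span of a cone are differences of points of the cone. -/
theorem exists_add_mem_of_mem_span {F : PointedCone ℝ (E n)} {x : E n}
    (hx : x ∈ Submodule.span ℝ (F : Set (E n))) : ∃ f ∈ F, x + f ∈ F := by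
  induction hx using Submodule.span_induction with
  | mem x h => exact ⟨0, F.zero_mem, by simpa using h⟩
  | zero => exact ⟨0, F.zero_mem, by simp⟩
  | add x y _ _ ihx ihy =>
    obtain ⟨f, hf, hf'⟩ := ihx
    obtain ⟨g, hg, hg'⟩ := ihy
    refine ⟨f + g, F.add_mem hf hg, ?_⟩
    have := F.add_mem hf' hg'
    rwa [add_add_add_comm] at this
  | smul a x _ ih =>
    obtain ⟨f, hf, hf'⟩ := ih
    rcases le_total 0 a with ha | ha
    · refine ⟨a • f, F.smul_mem ha hf, ?_⟩
      have : a • (x + f) ∈ F := F.smul_mem ha hf'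
      rwa [smul_add] at this
    · have ha' : 0 ≤ -a := neg_nonneg.2 ha
      refine ⟨(-a) • (x + f), F.smul_mem ha' hf', ?_⟩
      have : (-a) • f ∈ F := F.smul_mem ha' hf
      convert this using 1
      module

theorem dim_mono {C D : PointedCone ℝ (E n)} (h : C ≤ D) : dim C ≤ dim D :=
  Submodule.finrank_mono (Submodule.span_mono h)

theorem span_eq_of_le_of_dim_eq {C D : PointedCone ℝ (E n)} (h : C ≤ D) (hd : dim C = dim D) :
    Submodule.span ℝ (C : Set (E n)) = Submodule.span ℝ (D : Set (E n)) :=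
  Submodule.eq_of_le_of_finrank_eq (Submodule.span_mono h) hd

/-- Equal dimension gives equal spans, so a point of `D` becomes a point of `C` after adding some
point of `C`; the face property then puts it in `C`. -/
theorem eq_of_isFaceOf_of_dim_eq {C D : PointedCone ℝ (E n)} (h : C.IsFaceOf D)
    (hd : dim C = dim D) : C = D := by
  refine le_antisymm h.le fun x hx => ?_
  have hx' : x ∈ Submodule.span ℝ (C : Set (E n)) := by
    rw [span_eq_of_le_of_dim_eq h.le hd]
    exact Submodule.subset_span hx
  obtain ⟨f, hf, hxf⟩ := exists_add_mem_of_mem_span hx'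
  exact h.mem_of_add_mem_left hx (h.le hf) hxf

theorem inner_eq_zero_of_mem_span {s : Set (E n)} {u : E n} (h : ∀ y ∈ s, inner ℝ u y = 0)
    {x : E n} (hx : x ∈ Submodule.span ℝ s) : inner ℝ u x = 0 := by
  induction hx using Submodule.span_induction with
  | mem y hy => exact h y hy
  | zero => simp
  | add x y _ _ hx hy => rw [inner_add_right, hx, hy, add_zero]
  | smul a x _ hx => rw [inner_smul_right, hx, mul_zero]

theorem eq_zero_of_mem_span_of_inner_eq_zero {s : Set (E n)} {u : E n}
    (hu : u ∈ Submodule.span ℝ s) (h : ∀ y ∈ s, inner ℝ u y = 0) : u = 0 :=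
  inner_self_eq_zero.1 (inner_eq_zero_of_mem_span h hu)

theorem isFaceOf_hull_of_subset {s t : Finset (E n)} (hs : LinearIndepOn ℝ id (s : Set (E n)))
    (hts : t ⊆ s) :
    (PointedCone.hull ℝ (t : Set (E n))).IsFaceOf (PointedCone.hull ℝ (s : Set (E n))) := by
  classical
  refine PointedCone.IsFaceOf.of_mem_of_add_mem_left
    (Submodule.span_mono (by exact_mod_cast hts)) fun {x y} hx hy hxy => ?_
  obtain ⟨a, ha, rfl⟩ := mem_hull_finset.1 hx
  obtain ⟨b, hb, rfl⟩ := mem_hull_finset.1 hy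
  obtain ⟨c, hc, h⟩ := mem_hull_finset.1 hxy
  -- Extending `c` by zero makes both expansions run over `s`. Off `t`, independence gives `a v + b
  -- v = 0`, and both summands are nonnegative.
  have hc' : ∑ v ∈ s, (if v ∈ t then c v else 0) • v = ∑ v ∈ t, c v • v := by
    simp only [ite_smul, zero_smul]
    rw [← Finset.sum_filter, Finset.filter_mem_eq_inter, Finset.inter_eq_right.2 hts]
  have hab : ∑ v ∈ s, (a v + b v) • v = ∑ v ∈ s, (if v ∈ t then c v else 0) • v := by
    rw [hc', h]
    simp only [add_smul, Finset.sum_add_distrib]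
  have hzero : ∀ v ∈ s, v ∉ t → a v = 0 := fun v hv hvt => by
    have := coeff_eq_of_linearIndepOn hs hab hv
    rw [if_neg hvt] at this
    linarith [ha v, hb v]
  refine mem_hull_finset.2 ⟨a, ha, Finset.sum_subset hts fun v hv hvt => ?_⟩
  rw [hzero v hv hvt, zero_smul]

theorem dim_hull {s : Finset (E n)} (hs : LinearIndepOn ℝ id (s : Set (E n))) :
    dim (PointedCone.hull ℝ (s : Set (E n))) = s.card := by
  rw [dim, span_hull]
  exact finrank_span_finset_eq_card hs

theorem fg_hull (s : Finset (E n)) : (PointedCone.hull ℝ (s : Set (E n))).FG := ⟨s, rfl⟩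

theorem eq_of_mem_hull_singleton {v w : E n} (hv : ‖v‖ = 1) (hw : ‖w‖ = 1)
    (h : v ∈ PointedCone.hull ℝ {w}) : v = w := by
  obtain ⟨a, rfl⟩ := Submodule.mem_span_singleton.1 h
  change ‖(a : ℝ) • w‖ = 1 at hv
  change (a : ℝ) • w = w
  rw [norm_smul, hw, mul_one, Real.norm_of_nonneg a.2] at hv
  rw [hv, one_smul]

theorem vertices_hull {s : Finset (E n)} (hs : LinearIndepOn ℝ id (s : Set (E n)))
    (hunit : ∀ v ∈ s, ‖v‖ = 1) : vertices (PointedCone.hull ℝ (s : Set (E n))) = s := by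
  classical
  ext v
  rw [mem_vertices (fg_hull s)]
  constructor
  · rintro ⟨hv, hface⟩
    have hF := face_eq_hull hface
    have hne : ((s : Set (E n)) ∩ (PointedCone.hull ℝ {v} : Set (E n))).Nonempty := by
      by_contra hemp
      rw [Set.not_nonempty_iff_eq_empty.1 hemp] at hF
      have hv0 : v ∈ PointedCone.hull ℝ (∅ : Set (E n)) :=
        hF ▸ Submodule.mem_span_singleton_self v
      rw [PointedCone.hull, Submodule.span_empty, Submodule.mem_bot] at hv0
      simp [hv0] at hv
    obtain ⟨w, hws, hwv⟩ := hne
    rwa [← eq_of_mem_hull_singleton (hunit w hws) hv hwv]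
  · intro hv
    refine ⟨hunit v hv, ?_⟩
    have := isFaceOf_hull_of_subset hs (Finset.singleton_subset_iff.2 hv)
    rwa [Finset.coe_singleton] at this

/-- Independent generators may have any length; normalized, they become exactly the vertices by
`vertices_hull`. -/
theorem exists_finset_of_isSimplicial {S : PointedCone ℝ (E n)} (hS : S.IsSimplicial) :
    ∃ s : Finset (E n), LinearIndepOn ℝ id (s : Set (E n)) ∧ (∀ v ∈ s, ‖v‖ = 1) ∧
      PointedCone.hull ℝ (s : Set (E n)) = S := by
  classical
  obtain ⟨s, hfin, hli, rfl⟩ := hS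
  have hne : ∀ v ∈ s, v ≠ 0 := fun v hv => hli.ne_zero hv
  have hpos : ∀ v ∈ s, 0 < ‖v‖ := fun v hv => norm_pos_iff.2 (hne v hv)
  refine ⟨hfin.toFinset.image fun v => ‖v‖⁻¹ • v, ?_, ?_, ?_⟩
  · have h := LinearIndependent.units_smul hli
      fun v : s => Units.mk0 ‖(v : E n)‖⁻¹ (inv_ne_zero (hpos v v.2).ne')
    have h' := h.linearIndepOn_id
    convert h' using 1
    ext x
    simp [Units.smul_def]
  · simp only [Finset.mem_image, Set.Finite.mem_toFinset]
    rintro _ ⟨v, hv, rfl⟩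
    rw [norm_smul, norm_inv, norm_norm, inv_mul_cancel₀ (hpos v hv).ne']
  · refine le_antisymm (Submodule.span_le.2 ?_) (Submodule.span_le.2 ?_)
    · simp only [Finset.coe_image, Set.Finite.coe_toFinset]
      rintro _ ⟨v, hv, rfl⟩
      exact PointedCone.smul_mem _ (inv_nonneg.2 (norm_nonneg v)) (Submodule.subset_span hv)
    · intro v hv
      have hmem : ‖v‖⁻¹ • v ∈ PointedCone.hull ℝ
          ((hfin.toFinset.image fun v => ‖v‖⁻¹ • v : Finset (E n)) : Set (E n)) :=
        Submodule.subset_span (by simpa using ⟨v, hv, rfl⟩)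
      have := PointedCone.smul_mem _ (norm_nonneg v) hmem
      rwa [smul_smul, mul_inv_cancel₀ (hpos v hv).ne', one_smul] at this

/-! ### Simplicial cones: opposite facets, normals, and the recursion for one cone -/

section Simplicial

variable {S : PointedCone ℝ (E n)}

theorem hull_vertices (hS : S.IsSimplicial) :
    PointedCone.hull ℝ (vertices S : Set (E n)) = S := by
  obtain ⟨s, hs, hunit, rfl⟩ := exists_finset_of_isSimplicial hS
  rw [vertices_hull hs hunit]

theorem linearIndepOn_vertices (hS : S.IsSimplicial) :
    LinearIndepOn ℝ id (vertices S : Set (E n)) := by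
  obtain ⟨s, hs, hunit, rfl⟩ := exists_finset_of_isSimplicial hS
  rwa [vertices_hull hs hunit]

theorem fg_of_isSimplicial (hS : S.IsSimplicial) : S.FG := ⟨vertices S, hull_vertices hS⟩

theorem norm_eq_one_of_mem_vertices (hS : S.IsSimplicial) {v : E n} (hv : v ∈ vertices S) :
    ‖v‖ = 1 := ((mem_vertices (fg_of_isSimplicial hS)).1 hv).1

theorem vertices_hull_of_subset (hS : S.IsSimplicial) {t : Finset (E n)} (ht : t ⊆ vertices S) :
    vertices (PointedCone.hull ℝ (t : Set (E n))) = t :=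
  vertices_hull ((linearIndepOn_vertices hS).mono (by exact_mod_cast ht))
    fun _ hv => norm_eq_one_of_mem_vertices hS (ht hv)

theorem isSimplicial_hull_of_subset (hS : S.IsSimplicial) {t : Finset (E n)}
    (ht : t ⊆ vertices S) : (PointedCone.hull ℝ (t : Set (E n))).IsSimplicial :=
  .hull t.finite_toSet ((linearIndepOn_vertices hS).mono (by exact_mod_cast ht))

theorem dim_hull_of_subset (hS : S.IsSimplicial) {t : Finset (E n)}
    (ht : t ⊆ vertices S) : dim (PointedCone.hull ℝ (t : Set (E n))) = t.card :=
  dim_hull ((linearIndepOn_vertices hS).mono (by exact_mod_cast ht))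

theorem dim_eq_card_vertices (hS : S.IsSimplicial) : dim S = (vertices S).card := by
  rw [← dim_hull_of_subset hS Finset.Subset.rfl, hull_vertices hS]

theorem mem_of_mem_vertices (hS : S.IsSimplicial) {v : E n} (hv : v ∈ vertices S) : v ∈ S := by
  rw [← hull_vertices hS]
  exact Submodule.subset_span hv

theorem span_vertices (hS : S.IsSimplicial) :
    Submodule.span ℝ (vertices S : Set (E n)) = Submodule.span ℝ (S : Set (E n)) := by
  rw [← span_hull, hull_vertices hS]

theorem exists_coeff_of_mem_span (hS : S.IsSimplicial) {x : E n}
    (hx : x ∈ Submodule.span ℝ (S : Set (E n))) :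
    ∃ c : E n → ℝ, ∑ v ∈ vertices S, c v • v = x := by
  rw [← span_vertices hS] at hx
  obtain ⟨c, -, hc⟩ := Submodule.mem_span_finset.1 hx
  exact ⟨c, hc⟩

open Classical in
/-- A face of a simplicial cone is generated by the vertices it contains. -/
theorem face_eq_hull_filter (hS : S.IsSimplicial) {F : PointedCone ℝ (E n)} (hF : F.IsFaceOf S) :
    F = PointedCone.hull ℝ ((vertices S).filter (· ∈ F) : Set (E n)) := by
  have hF' := hF
  rw [← hull_vertices hS] at hF'
  have h := face_eq_hull hF'
  convert h using 2
  ext v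
  simp

open Classical in
/-- The facet of the simplicial cone `S` opposite to the vertex `v`. -/
noncomputable def oppFacet (S : PointedCone ℝ (E n)) (v : E n) : PointedCone ℝ (E n) :=
  PointedCone.hull ℝ ((vertices S).erase v : Set (E n))

open Classical in
theorem vertices_oppFacet (hS : S.IsSimplicial) (v : E n) :
    vertices (oppFacet S v) = (vertices S).erase v :=
  vertices_hull_of_subset hS (Finset.erase_subset _ _)

theorem isSimplicial_oppFacet (hS : S.IsSimplicial) (v : E n) : (oppFacet S v).IsSimplicial := by
  classical
  exact isSimplicial_hull_of_subset hS (Finset.erase_subset _ _)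

theorem isFacet_oppFacet (hS : S.IsSimplicial) {v : E n} (hv : v ∈ vertices S) :
    IsFacet S (oppFacet S v) := by
  classical
  constructor
  · have := isFaceOf_hull_of_subset (linearIndepOn_vertices hS)
      (Finset.erase_subset v (vertices S))
    rwa [hull_vertices hS] at this
  · rw [dim_eq_card_vertices hS, dim_eq_card_vertices (isSimplicial_oppFacet hS v),
      vertices_oppFacet hS, Finset.card_erase_add_one hv]

/-- Facets of simplicial cones are opposite to vertices. -/
theorem exists_eq_oppFacet (hS : S.IsSimplicial) {F : PointedCone ℝ (E n)} (hF : IsFacet S F) :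
    ∃ v ∈ vertices S, F = oppFacet S v := by
  classical
  have h := face_eq_hull_filter hS hF.1
  have hsub : (vertices S).filter (· ∈ F) ⊆ vertices S := Finset.filter_subset _ _
  have hcard : ((vertices S).filter (· ∈ F)).card + 1 = (vertices S).card := by
    rw [← dim_hull_of_subset hS hsub, ← h, ← dim_eq_card_vertices hS]
    exact hF.2
  obtain ⟨v, hv, hv'⟩ : ∃ v ∈ vertices S, v ∉ (vertices S).filter (· ∈ F) := by
    by_contra! hcon
    have := Finset.card_le_card (show vertices S ⊆ (vertices S).filter (· ∈ F) from hcon)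
    omega
  refine ⟨v, hv, ?_⟩
  have heq : (vertices S).filter (· ∈ F) = (vertices S).erase v := by
    refine Finset.eq_of_subset_of_card_le (fun w hw => Finset.mem_erase.2 ⟨?_, hsub hw⟩) ?_
    · rintro rfl
      exact hv' hw
    · rw [Finset.card_erase_of_mem hv]
      omega
  rw [h, heq]
  rfl

/-- The inward unit normal of the facet of `S` opposite to the vertex `v`. -/
noncomputable def oppNormal (S : PointedCone ℝ (E n)) (v : E n) : E n :=
  inwardNormal S (oppFacet S v)

theorem oppNormal_spec (hS : S.IsSimplicial) {v : E n} (hv : v ∈ vertices S) :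
    IsInwardUnitNormal S (oppFacet S v) (oppNormal S v) :=
  inwardNormal_spec (isFacet_oppFacet hS hv)

theorem mem_oppFacet (S : PointedCone ℝ (E n)) {v w : E n} (hw : w ∈ vertices S) (hwv : w ≠ v) :
    w ∈ oppFacet S v := by
  classical
  exact Submodule.subset_span (by simp [hw, hwv])

theorem inner_oppNormal_of_ne (hS : S.IsSimplicial) {v w : E n} (hv : v ∈ vertices S)
    (hw : w ∈ vertices S) (hwv : w ≠ v) : inner ℝ (oppNormal S v) w = 0 :=
  (oppNormal_spec hS hv).2.2.1 w (mem_oppFacet S hw hwv)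

/-- A vector of the span orthogonal to all vertices vanishes. -/
theorem eq_zero_of_inner_vertices (hS : S.IsSimplicial) {u : E n}
    (hu : u ∈ Submodule.span ℝ (S : Set (E n))) (h : ∀ w ∈ vertices S, inner ℝ u w = 0) :
    u = 0 := by
  rw [← span_vertices hS] at hu
  exact eq_zero_of_mem_span_of_inner_eq_zero hu h

theorem inner_oppNormal_pos (hS : S.IsSimplicial) {v : E n} (hv : v ∈ vertices S) :
    0 < inner ℝ (oppNormal S v) v := by
  have hn := oppNormal_spec hS hv
  refine lt_of_le_of_ne (hn.2.2.2 v (mem_of_mem_vertices hS hv)) fun h0 => ?_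
  have : oppNormal S v = 0 := eq_zero_of_inner_vertices hS hn.1 fun w hw => by
    by_cases hwv : w = v
    · rw [hwv, ← h0]
    · exact inner_oppNormal_of_ne hS hv hw hwv
  have h1 := hn.2.1
  simp [this] at h1

/-- Up to scaling, the opposite normals are the basis dual to the vertices, so pairing with them
reads off coefficients. -/
theorem inner_oppNormal_sum (hS : S.IsSimplicial) {v : E n} (hv : v ∈ vertices S) (c : E n → ℝ) :
    inner ℝ (oppNormal S v) (∑ w ∈ vertices S, c w • w) = c v * inner ℝ (oppNormal S v) v := by
  rw [inner_sum, Finset.sum_eq_single_of_mem v hv fun w hw hwv => ?_, real_inner_smul_right]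
  rw [real_inner_smul_right, inner_oppNormal_of_ne hS hv hw hwv, mul_zero]

/-- Half-space description of a simplicial cone. -/
theorem mem_iff_inner_oppNormal_nonneg (hS : S.IsSimplicial) {x : E n}
    (hx : x ∈ Submodule.span ℝ (S : Set (E n))) :
    x ∈ S ↔ ∀ v ∈ vertices S, 0 ≤ inner ℝ (oppNormal S v) x := by
  refine ⟨fun h v hv => (oppNormal_spec hS hv).2.2.2 x h, fun h => ?_⟩
  obtain ⟨c, rfl⟩ := exists_coeff_of_mem_span hS hx
  refine Submodule.sum_mem _ fun v hv => PointedCone.smul_mem _ ?_ (mem_of_mem_vertices hS hv)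
  have := h v hv
  rw [inner_oppNormal_sum hS hv] at this
  exact nonneg_of_mul_nonneg_left this (inner_oppNormal_pos hS hv)

/-- Closedness is needed to pass to the limit along segments in `exists_mem_add_smul_mem`. -/
theorem isClosed_of_isSimplicial (hS : S.IsSimplicial) : IsClosed (S : Set (E n)) := by
  have h : (S : Set (E n)) = (Submodule.span ℝ (S : Set (E n)) : Set (E n)) ∩
      ⋂ v ∈ vertices S, {x | 0 ≤ inner ℝ (oppNormal S v) x} := by
    ext x
    simp only [Set.mem_inter_iff, Set.mem_iInter, Set.mem_ofPred_eq, SetLike.mem_coe]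
    exact ⟨fun hx => ⟨Submodule.subset_span hx,
      (mem_iff_inner_oppNormal_nonneg hS (Submodule.subset_span hx)).1 hx⟩,
      fun hx => (mem_iff_inner_oppNormal_nonneg hS hx.1).2 hx.2⟩
  rw [h]
  refine (Submodule.closed_of_finiteDimensional _).inter
    (isClosed_biInter fun v _ => isClosed_le continuous_const (by fun_prop))

/-- Unit normals of a facet are unique up to sign. -/
theorem eq_or_eq_neg_oppNormal (hS : S.IsSimplicial) {v : E n} (hv : v ∈ vertices S) {m : E n}
    (hm : m ∈ Submodule.span ℝ (S : Set (E n))) (hm1 : ‖m‖ = 1)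
    (h0 : ∀ y ∈ oppFacet S v, inner ℝ m y = 0) :
    m = oppNormal S v ∨ m = -oppNormal S v := by
  have hn := oppNormal_spec hS hv
  have hpos := inner_oppNormal_pos hS hv
  -- With this factor, `m - a • oppNormal S v` is orthogonal to `v` as well as to the other
  -- vertices, hence zero.
  set a : ℝ := inner ℝ m v / inner ℝ (oppNormal S v) v with ha
  have hz : m - a • oppNormal S v = 0 := by
    refine eq_zero_of_inner_vertices hS (Submodule.sub_mem _ hm (Submodule.smul_mem _ _ hn.1))
      fun w hw => ?_
    rw [inner_sub_left, real_inner_smul_left]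
    by_cases hwv : w = v
    · rw [hwv, ha, div_mul_cancel₀ _ hpos.ne', sub_self]
    · rw [inner_oppNormal_of_ne hS hv hw hwv, h0 w (mem_oppFacet S hw hwv), mul_zero, sub_self]
  have hma := sub_eq_zero.1 hz
  have habs : |a| = 1 := by
    have := hm1
    rwa [hma, norm_smul, hn.2.1, mul_one, Real.norm_eq_abs] at this
  rcases (abs_eq zero_le_one).1 habs with h | h
  · left
    rw [hma, h, one_smul]
  · right
    rw [hma, h, neg_one_smul]

/-- Base times height for simplicial cones. -/
theorem paraVol_eq_mul (hS : S.IsSimplicial) {v : E n} (hv : v ∈ vertices S) :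
    paraVol S = inner ℝ (oppNormal S v) v * paraVol (oppFacet S v) := by
  classical
  have hn := oppNormal_spec hS hv
  have hpos := inner_oppNormal_pos hS hv
  rw [paraVol, paraVol, dim_eq_card_vertices hS,
    dim_eq_card_vertices (isSimplicial_oppFacet hS v), vertices_oppFacet hS]
  refine euclideanHausdorffMeasure_real_parallelepiped_eq_mul hv hn.2.1
    (fun w hw => inner_oppNormal_of_ne hS hv (Finset.mem_of_mem_erase hw)
      (Finset.ne_of_mem_erase hw)) hpos.le ?_
  have hmem : v - inner ℝ (oppNormal S v) v • oppNormal S v ∈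
      Submodule.span ℝ (S : Set (E n)) :=
    Submodule.sub_mem _ (Submodule.subset_span (mem_of_mem_vertices hS hv))
      (Submodule.smul_mem _ _ hn.1)
  obtain ⟨c, hc⟩ := exists_coeff_of_mem_span hS hmem
  -- The foot of the perpendicular from `v` is orthogonal to the normal, so its coefficient at `v`
  -- vanishes and it lies in the span of the opposite facet.
  have h0 : c v * inner ℝ (oppNormal S v) v = 0 := by
    rw [← inner_oppNormal_sum hS hv, hc, inner_sub_right, real_inner_smul_right,
      real_inner_self_eq_norm_sq, hn.2.1]
    ring
  have hcv : c v = 0 := (mul_eq_zero.1 h0).resolve_right hpos.ne'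
  rw [← hc, ← Finset.add_sum_erase _ _ hv, hcv, zero_smul, zero_add]
  exact Submodule.sum_mem _ fun w hw => Submodule.smul_mem _ _ (Submodule.subset_span hw)

theorem linForm_sum_smul (s : Finset (E n)) (c : E n → ℝ) :
    linForm (∑ v ∈ s, c v • v) = ∑ v ∈ s, MvPolynomial.C (c v) * linForm v := by
  simp only [linForm, Finset.mul_sum]
  rw [Finset.sum_comm]
  refine Finset.sum_congr rfl fun i _ => ?_
  simp only [WithLp.ofLp_sum, WithLp.ofLp_smul, Finset.sum_apply, Pi.smul_apply, smul_eq_mul,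
    map_sum, map_mul, Finset.sum_mul, mul_assoc]

/-- The facet recursion for a simplicial cone. -/
theorem linForm_mul_paraVol (hS : S.IsSimplicial) {u : E n}
    (hu : u ∈ Submodule.span ℝ (S : Set (E n))) :
    linForm u * MvPolynomial.C (paraVol S) = ∑ v ∈ vertices S,
      MvPolynomial.C (inner ℝ u (oppNormal S v) * paraVol (oppFacet S v)) * linForm v := by
  obtain ⟨c, rfl⟩ := exists_coeff_of_mem_span hS hu
  rw [linForm_sum_smul, Finset.sum_mul]
  refine Finset.sum_congr rfl fun v hv => ?_
  rw [real_inner_comm, inner_oppNormal_sum hS hv, paraVol_eq_mul hS hv]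
  simp only [map_mul]
  ring

end Simplicial

/-! ### Limit arguments along segments, and faces cut out by normals -/

open Filter Topology in
-- Pigeonhole along a filter: if every member of the finite set `T` failed eventually, all would
-- fail simultaneously.
theorem exists_frequently_of_forall_exists {α β : Type*} {l : Filter α} [l.NeBot] {T : Finset β}
    {P : β → α → Prop} (h : ∀ᶠ a in l, ∃ S ∈ T, P S a) : ∃ S ∈ T, ∃ᶠ a in l, P S a := by
  by_contra! hcon
  have hall : ∀ᶠ a in l, ∀ S ∈ T, ¬ P S a :=
    (Filter.eventually_all_finset T).2 hcon
  obtain ⟨a, ⟨S, hS, hP⟩, hn⟩ := (h.and hall).exists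
  exact hn S hS hP

open Filter Topology in
theorem tendsto_add_smul_nhdsGT (y z : E n) :
    Tendsto (fun t : ℝ => y + t • z) (𝓝[>] 0) (𝓝 y) := by
  have h : Continuous fun t : ℝ => y + t • z := by fun_prop
  have := h.tendsto 0
  simp only [zero_smul, add_zero] at this
  exact this.mono_left nhdsWithin_le_nhds

open Filter Topology in
/-- A cone not contained in any of finitely many subspaces has a point outside all of them. -/
theorem exists_mem_forall_notMem {F : PointedCone ℝ (E n)}
    (W : Finset (Submodule ℝ (E n))) (hW : ∀ w ∈ W, ∃ f ∈ F, f ∉ w) :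
    ∃ x ∈ F, ∀ w ∈ W, x ∉ w := by
  classical
  induction W using Finset.induction_on with
  | empty => exact ⟨0, F.zero_mem, by simp⟩
  | insert w W _ ih =>
    obtain ⟨x, hx, hxW⟩ := ih fun w' hw' => hW w' (Finset.mem_insert_of_mem hw')
    obtain ⟨f, hf, hfw⟩ := hW w (Finset.mem_insert_self _ _)
    by_cases hxw : x ∈ w
    -- A small push in the direction `f` leaves `w`, while the subspaces already avoided stay
    -- avoided because their complements are open.
    · have hev : ∀ᶠ t : ℝ in 𝓝[>] 0, ∀ w' ∈ W, x + t • f ∉ w' := by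
        refine (Filter.eventually_all_finset W).2 fun w' hw' => ?_
        exact (tendsto_add_smul_nhdsGT x f).eventually
          (w'.closed_of_finiteDimensional.isOpen_compl.mem_nhds (hxW w' hw'))
      obtain ⟨t, ht, ht0⟩ := (hev.and self_mem_nhdsWithin).exists
      have ht0 : 0 < t := ht0
      refine ⟨x + t • f, F.add_mem hx (PointedCone.smul_mem _ ht0.le hf), ?_⟩
      intro w' hw'
      rcases Finset.mem_insert.1 hw' with rfl | hw'
      · intro hmem
        exact hfw (((w'.smul_mem_iff ht0.ne').1 ((w'.add_mem_iff_right hxw).1 hmem)))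
      · exact ht w' hw'
    · refine ⟨x, hx, fun w' hw' => ?_⟩
      rcases Finset.mem_insert.1 hw' with rfl | hw'
      · exact hxw
      · exact hxW w' hw'

theorem fg_of_isFaceOf {C F : PointedCone ℝ (E n)} (hC : C.FG) (hF : F.IsFaceOf C) : F.FG := by
  obtain ⟨s, rfl⟩ := hC
  have hfin : ((s : Set (E n)) ∩ F).Finite := s.finite_toSet.subset Set.inter_subset_left
  exact ⟨hfin.toFinset, by rw [hfin.coe_toFinset]; exact (face_eq_hull hF).symm⟩

theorem inf_isFaceOf_of_le {C F S : PointedCone ℝ (E n)} (hF : F.IsFaceOf C) (hS : S ≤ C) :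
    (S ⊓ F).IsFaceOf S := by
  have h := (PointedCone.IsFaceOf.refl S).inf hF
  rwa [inf_eq_left.2 hS] at h

/-- Used with the sum of the vertices of a simplicial cone as its relative interior point: a face
containing it contains all of them. -/
theorem subset_of_sum_mem {S F : PointedCone ℝ (E n)} (hF : F.IsFaceOf S) {t : Finset (E n)}
    (ht : ∀ w ∈ t, w ∈ S) (h : ∑ w ∈ t, w ∈ F) {w : E n} (hw : w ∈ t) : w ∈ F := by
  classical
  rw [← Finset.add_sum_erase _ _ hw] at h
  exact hF.mem_of_add_mem_left (ht w hw)
    (Submodule.sum_mem _ fun x hx => ht x (Finset.mem_of_mem_erase hx)) h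

/-- The part of a cone orthogonal to a vector. -/
def orthFace (C : PointedCone ℝ (E n)) (m : E n) : PointedCone ℝ (E n) where
  carrier := {x | x ∈ C ∧ inner ℝ m x = 0}
  add_mem' := fun {x y} hx hy =>
    ⟨C.add_mem hx.1 hy.1, by rw [inner_add_right, hx.2, hy.2, add_zero]⟩
  zero_mem' := ⟨C.zero_mem, inner_zero_right m⟩
  smul_mem' := fun a x hx => by
    refine ⟨Submodule.smul_mem C a hx.1, ?_⟩
    change inner ℝ m ((a : ℝ) • x) = 0
    rw [real_inner_smul_right, hx.2, mul_zero]

theorem orthFace_isFaceOf {C : PointedCone ℝ (E n)} {m : E n} (hm : ∀ y ∈ C, 0 ≤ inner ℝ m y) :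
    (orthFace C m).IsFaceOf C := by
  refine PointedCone.IsFaceOf.of_mem_of_add_mem_left (fun x hx => hx.1) fun {x y} hx hy hxy => ?_
  have h := hxy.2
  rw [inner_add_right] at h
  exact ⟨hx, by linarith [hm x hx, hm y hy]⟩

/-- With equal dimensions, `m` would lie in the span of vectors orthogonal to it, forcing `m = 0`.
-/
theorem dim_orthFace_lt {C : PointedCone ℝ (E n)} {m : E n}
    (hm : m ∈ Submodule.span ℝ (C : Set (E n))) (hm1 : ‖m‖ = 1) :
    dim (orthFace C m) < dim C := by
  have hle : orthFace C m ≤ C := fun x hx => hx.1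
  refine lt_of_le_of_ne (dim_mono hle) fun heq => ?_
  have hm' : m ∈ Submodule.span ℝ (orthFace C m : Set (E n)) := by
    rwa [span_eq_of_le_of_dim_eq hle heq]
  have h0 : m = 0 := eq_zero_of_mem_span_of_inner_eq_zero hm' fun y hy => hy.2
  simp [h0] at hm1

/-- A facet is cut out by its inward normal. -/
theorem eq_orthFace {C F : PointedCone ℝ (E n)} (hF : IsFacet C F) :
    F = orthFace C (inwardNormal C F) := by
  have hn := inwardNormal_spec hF
  have hle : F ≤ orthFace C (inwardNormal C F) := fun x hx => ⟨hF.1.le hx, hn.2.2.1 x hx⟩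
  refine eq_of_isFaceOf_of_dim_eq
    ((hF.1.isFaceOf_iff_le (orthFace_isFaceOf hn.2.2.2)).2 hle) ?_
  have h1 := dim_mono hle
  have h2 := dim_orthFace_lt hn.1 hn.2.1
  have h3 := hF.2
  omega

theorem inwardNormal_eq {C F : PointedCone ℝ (E n)} (hF : IsFacet C F) {m : E n}
    (hm : IsInwardUnitNormal C F m) : inwardNormal C F = m :=
  (existsUnique_isInwardUnitNormal hF).unique (inwardNormal_spec hF) hm

/-! ### Adjacency of cones in a triangulation -/

namespace IsTriangulation

variable {C : PointedCone ℝ (E n)} {T : Finset (PointedCone ℝ (E n))}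

theorem le (hT : IsTriangulation C T) {S : PointedCone ℝ (E n)} (hS : S ∈ T) : S ≤ C := by
  have h : (S : Set (E n)) ⊆ C := by
    rw [← hT.iUnion_eq]
    exact Set.subset_biUnion_of_mem (u := fun S : PointedCone ℝ (E n) => (S : Set (E n))) hS
  exact h

theorem exists_mem (hT : IsTriangulation C T) {x : E n} (hx : x ∈ C) : ∃ S ∈ T, x ∈ S := by
  have h : x ∈ (C : Set (E n)) := hx
  rw [← hT.iUnion_eq] at h
  simpa using h

theorem span_eq (hT : IsTriangulation C T) {S : PointedCone ℝ (E n)} (hS : S ∈ T) :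
    Submodule.span ℝ (S : Set (E n)) = Submodule.span ℝ (C : Set (E n)) :=
  span_eq_of_le_of_dim_eq (hT.le hS) (hT.dim_eq S hS)

open Filter Topology in
/-- Some cone of a triangulation contains `y` together with a point `y + t • z`, `t > 0`. -/
theorem exists_mem_add_smul_mem (hT : IsTriangulation C T) {y z : E n} (hy : y ∈ C) (hz : z ∈ C) :
    ∃ S ∈ T, y ∈ S ∧ ∃ t : ℝ, 0 < t ∧ y + t • z ∈ S := by
  have hev : ∀ᶠ t : ℝ in 𝓝[>] 0, ∃ S ∈ T, 0 < t ∧ y + t • z ∈ S := by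
    filter_upwards [self_mem_nhdsWithin] with t ht
    have ht : 0 < t := ht
    obtain ⟨S, hS, h⟩ := hT.exists_mem (C.add_mem hy (PointedCone.smul_mem _ ht.le hz))
    exact ⟨S, hS, ht, h⟩
  -- A single cone contains `y + t • z` for arbitrarily small `t > 0`; being closed, it contains the
  -- limit `y`.
  obtain ⟨S, hS, hfreq⟩ := exists_frequently_of_forall_exists hev
  exact ⟨S, hS, (isClosed_of_isSimplicial (hT.simplicial S hS)).mem_of_frequently_of_tendsto
    (hfreq.mono fun t h => h.2) (tendsto_add_smul_nhdsGT y z), hfreq.exists⟩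

-- Two cones on the same side of a common facet overlap: a point just off the relative interior of
-- that facet, towards `v`, lies in both. Their intersection is a face of `S`, so it then contains
-- every vertex of `S`.
open Filter Topology in
theorem le_of_oppFacet_eq (hT : IsTriangulation C T) {S S' : PointedCone ℝ (E n)} (hS : S ∈ T)
    (hS' : S' ∈ T) {v v' : E n} (hv : v ∈ vertices S) (hv' : v' ∈ vertices S')
    (hG : oppFacet S v = oppFacet S' v') (hn : oppNormal S v = oppNormal S' v') : S ≤ S' := by
  classical
  have hs := hT.simplicial S hS
  have hs' := hT.simplicial S' hS'
  have hV : (vertices S).erase v = (vertices S').erase v' := by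
    rw [← vertices_oppFacet hs, hG, vertices_oppFacet hs']
  set y := ∑ w ∈ (vertices S).erase v, w with hy
  have hyS : y ∈ S := Submodule.sum_mem _ fun w hw =>
    mem_of_mem_vertices hs (Finset.mem_of_mem_erase hw)
  have hvS : v ∈ S := mem_of_mem_vertices hs hv
  have hyG : y ∈ oppFacet S' v' := by
    rw [hy, hV]
    exact Submodule.sum_mem _ fun w hw => Submodule.subset_span hw
  -- The inequality at `v'` holds for every `t > 0` because the two normals agree; all others are
  -- strict at `y` and persist for small `t`.
  have hev : ∀ᶠ t : ℝ in 𝓝[>] 0, ∀ w ∈ vertices S', 0 ≤ inner ℝ (oppNormal S' w) (y + t • v) := by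
    refine (Filter.eventually_all_finset _).2 fun w hw => ?_
    by_cases hwv : w = v'
    · filter_upwards [self_mem_nhdsWithin] with t ht
      have ht : 0 < t := ht
      rw [hwv, inner_add_right, (oppNormal_spec hs' hv').2.2.1 y hyG, zero_add,
        real_inner_smul_right, ← hn]
      exact mul_nonneg ht.le (inner_oppNormal_pos hs hv).le
    · have hyw : 0 < inner ℝ (oppNormal S' w) y := by
        rw [hy, hV, inner_sum, Finset.sum_eq_single_of_mem w (Finset.mem_erase.2 ⟨hwv, hw⟩)]
        · exact inner_oppNormal_pos hs' hw
        · exact fun x hx hxw => inner_oppNormal_of_ne hs' hw (Finset.mem_of_mem_erase hx) hxw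
      have hlim := (tendsto_add_smul_nhdsGT y v).inner (𝕜 := ℝ)
        (tendsto_const_nhds (x := oppNormal S' w))
      filter_upwards [hlim.eventually (lt_mem_nhds (by rwa [real_inner_comm] at hyw))] with t ht
      rw [real_inner_comm]
      exact ht.le
  obtain ⟨t, ht, ht0⟩ := (hev.and self_mem_nhdsWithin).exists
  have ht0 : 0 < t := ht0
  have hxS : y + t • v ∈ S := S.add_mem hyS (PointedCone.smul_mem _ ht0.le hvS)
  have hxS' : y + t • v ∈ S' := by
    refine (mem_iff_inner_oppNormal_nonneg hs' ?_).2 ht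
    rw [hT.span_eq hS', ← hT.span_eq hS]
    exact Submodule.subset_span hxS
  have hface := (hT.inter_face S hS S' hS').1
  have hxI : y + t • v ∈ S ⊓ S' := ⟨hxS, hxS'⟩
  have hyI : y ∈ S ⊓ S' :=
    hface.mem_of_add_mem_left hyS (PointedCone.smul_mem _ ht0.le hvS) hxI
  have hvI : v ∈ S ⊓ S' := hface.mem_of_smul_add_mem hvS hyS ht0 (by rwa [add_comm])
  have hsub : (vertices S : Set (E n)) ⊆ (S ⊓ S' : PointedCone ℝ (E n)) := fun w hw => by
    by_cases hwv : w = v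
    · rwa [hwv]
    · exact subset_of_sum_mem hface
        (fun x hx => mem_of_mem_vertices hs (Finset.mem_of_mem_erase hx)) hyI
        (Finset.mem_erase.2 ⟨hwv, hw⟩)
  have hle : PointedCone.hull ℝ (vertices S : Set (E n)) ≤ S ⊓ S' := Submodule.span_le.2 hsub
  rw [hull_vertices hs] at hle
  exact hle.trans inf_le_right

/-- A cone of a triangulation is determined by one of its facets and the side it lies on. -/
theorem eq_of_oppFacet_eq (hT : IsTriangulation C T) {S S' : PointedCone ℝ (E n)} (hS : S ∈ T)
    (hS' : S' ∈ T) {v v' : E n} (hv : v ∈ vertices S) (hv' : v' ∈ vertices S')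
    (hG : oppFacet S v = oppFacet S' v') (hn : oppNormal S v = oppNormal S' v') :
    S = S' ∧ v = v' := by
  classical
  obtain rfl : S = S' := le_antisymm (hT.le_of_oppFacet_eq hS hS' hv hv' hG hn)
    (hT.le_of_oppFacet_eq hS' hS hv' hv hG.symm hn.symm)
  refine ⟨rfl, ?_⟩
  have hs := hT.simplicial S hS
  by_contra hne
  have h : (vertices S).erase v = (vertices S).erase v' := by
    rw [← vertices_oppFacet hs, hG, vertices_oppFacet hs]
  have hmem : v ∈ (vertices S).erase v' := Finset.mem_erase.2 ⟨hne, hv⟩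
  rw [← h] at hmem
  exact Finset.notMem_erase _ _ hmem

/-- An interior facet of a cone of a triangulation has a cone on its other side. -/
theorem exists_opposite (hT : IsTriangulation C T) {S : PointedCone ℝ (E n)} (hS : S ∈ T)
    {v : E n} (hv : v ∈ vertices S) {z : E n} (hz : z ∈ C) (hneg : inner ℝ (oppNormal S v) z < 0) :
    ∃ S' ∈ T, ∃ v' ∈ vertices S', oppFacet S' v' = oppFacet S v ∧
      oppNormal S' v' = -oppNormal S v := by
  classical
  have hs := hT.simplicial S hS
  have hfacet := isFacet_oppFacet hs hv
  have hn := oppNormal_spec hs hv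
  set y := ∑ w ∈ (vertices S).erase v, w with hy
  have hyG : y ∈ oppFacet S v := Submodule.sum_mem _ fun w hw => Submodule.subset_span hw
  have hyS : y ∈ S := hfacet.1.le hyG
  -- `S'` contains the relative interior point `y` of the facet and a point strictly beyond it.
  obtain ⟨S', hS', hyS', t, ht, htS'⟩ := hT.exists_mem_add_smul_mem (hT.le hS hyS) hz
  have hs' := hT.simplicial S' hS'
  have htneg : inner ℝ (oppNormal S v) (y + t • z) < 0 := by
    rw [inner_add_right, hn.2.2.1 y hyG, zero_add, real_inner_smul_right]
    exact mul_neg_of_pos_of_neg ht hneg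
  have hface := (hT.inter_face S hS S' hS').1
  have hface' := (hT.inter_face S hS S' hS').2
  have hne : S ≠ S' := by
    rintro rfl
    exact absurd (hn.2.2.2 _ htS') (not_le.2 htneg)
  have hGle : oppFacet S v ≤ S ⊓ S' := Submodule.span_le.2 fun w hw =>
    subset_of_sum_mem hface (fun x hx => mem_of_mem_vertices hs (Finset.mem_of_mem_erase hx))
      ⟨hyS, hyS'⟩ hw
  -- A common face of full dimension would equal both cones. So `S ⊓ S'` contains the facet and has
  -- smaller dimension than `S`, hence is the facet.
  have hdimlt : dim (S ⊓ S') < dim S := by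
    refine lt_of_le_of_ne (dim_mono inf_le_left) fun heq => hne ?_
    rw [← eq_of_isFaceOf_of_dim_eq hface heq]
    refine eq_of_isFaceOf_of_dim_eq hface' ?_
    rw [heq, hT.dim_eq S hS, hT.dim_eq S' hS']
  have hGeq : oppFacet S v = S ⊓ S' := by
    refine eq_of_isFaceOf_of_dim_eq ((hfacet.1.isFaceOf_iff_le hface).2 hGle) ?_
    have h1 := dim_mono hGle
    have h2 := hfacet.2
    omega
  have hfacet' : IsFacet S' (oppFacet S v) := by
    refine ⟨hGeq ▸ hface', ?_⟩
    rw [hfacet.2, hT.dim_eq S hS, hT.dim_eq S' hS']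
  obtain ⟨v', hv', hG'⟩ := exists_eq_oppFacet hs' hfacet'
  refine ⟨S', hS', v', hv', hG'.symm, ?_⟩
  have hn' := oppNormal_spec hs' hv'
  rcases eq_or_eq_neg_oppNormal hs hv (m := oppNormal S' v')
    (by rw [hT.span_eq hS, ← hT.span_eq hS']; exact hn'.1) hn'.2.1
    (by rw [hG']; exact hn'.2.2.1) with h | h
  -- Equal normals would put both cones on the same side and make them equal.
  · exact absurd (hT.eq_of_oppFacet_eq hS hS' hv hv' hG' h.symm).1 hne
  · exact h

/-- A facet of a cone of a triangulation lying on the boundary lies in a unique facet. -/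
theorem boundary_spec (hT : IsTriangulation C T) {S : PointedCone ℝ (E n)} (hS : S ∈ T)
    {v : E n} (hv : v ∈ vertices S) (hpos : ∀ y ∈ C, 0 ≤ inner ℝ (oppNormal S v) y) :
    IsFacet C (orthFace C (oppNormal S v)) ∧
      inwardNormal C (orthFace C (oppNormal S v)) = oppNormal S v ∧
      S ⊓ orthFace C (oppNormal S v) = oppFacet S v := by
  have hs := hT.simplicial S hS
  have hfacet := isFacet_oppFacet hs hv
  have hn := oppNormal_spec hs hv
  set F := orthFace C (oppNormal S v) with hF
  have hspan : oppNormal S v ∈ Submodule.span ℝ (C : Set (E n)) := hT.span_eq hS ▸ hn.1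
  have hlt : dim F < dim C := dim_orthFace_lt hspan hn.2.1
  have hface : F.IsFaceOf C := orthFace_isFaceOf hpos
  have hle : oppFacet S v ≤ S ⊓ F := fun x hx =>
    ⟨hfacet.1.le hx, hT.le hS (hfacet.1.le hx), hn.2.2.1 x hx⟩
  have h1 := dim_mono hle
  have h2 := dim_mono (inf_le_right : S ⊓ F ≤ F)
  have h3 := hfacet.2
  have h4 := hT.dim_eq S hS
  have hFacet : IsFacet C F := ⟨hface, by omega⟩
  refine ⟨hFacet, inwardNormal_eq hFacet ⟨hspan, hn.2.1, fun y hy => hy.2, hpos⟩, ?_⟩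
  refine (eq_of_isFaceOf_of_dim_eq ((hfacet.1.isFaceOf_iff_le
    (inf_isFaceOf_of_le hface (hT.le hS))).2 hle) ?_).symm
  omega

/-- The dimension condition makes `S ⊓ F` a facet of `S`. The normal of `F` also serves for it,
since `S` and `C` have the same span, and inward unit normals are unique. -/
theorem exists_vertex_of_dim_inf (hT : IsTriangulation C T) {S F : PointedCone ℝ (E n)}
    (hS : S ∈ T) (hF : IsFacet C F) (hd : dim (S ⊓ F) + 1 = dim C) :
    ∃ v ∈ vertices S, S ⊓ F = oppFacet S v ∧ oppNormal S v = inwardNormal C F := by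
  have hs := hT.simplicial S hS
  obtain ⟨v, hv, h⟩ := exists_eq_oppFacet hs
    (F := S ⊓ F) ⟨inf_isFaceOf_of_le hF.1 (hT.le hS), by rw [hd, hT.dim_eq S hS]⟩
  refine ⟨v, hv, h, inwardNormal_eq (isFacet_oppFacet hs hv) ?_⟩
  have hn := inwardNormal_spec hF
  rw [← h]
  exact ⟨(hT.span_eq hS).symm ▸ hn.1, hn.2.1, fun y hy => hn.2.2.1 y hy.2,
    fun y hy => hn.2.2.2 y (hT.le hS hy)⟩

end IsTriangulation

/-! ### Induced triangulations of the facets -/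

open Classical in
/-- The trace of a collection of cones in `C` on a face `F` of codimension one. -/
noncomputable def trace (C : PointedCone ℝ (E n)) (T : Finset (PointedCone ℝ (E n)))
    (F : PointedCone ℝ (E n)) : Finset (PointedCone ℝ (E n)) :=
  (T.filter fun S => dim (S ⊓ F) + 1 = dim C).image fun S => S ⊓ F

namespace IsTriangulation

variable {C : PointedCone ℝ (E n)} {T : Finset (PointedCone ℝ (E n))}

theorem mem_trace {F G : PointedCone ℝ (E n)} :
    G ∈ trace C T F ↔ ∃ S ∈ T, dim (S ⊓ F) + 1 = dim C ∧ S ⊓ F = G := by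
  simp [trace, and_assoc]

/-- A triangulation of `C` induces a triangulation of each facet. -/
theorem isTriangulation_trace (hC : C.FG) (hT : IsTriangulation C T) {F : PointedCone ℝ (E n)}
    (hF : IsFacet C F) : IsTriangulation F (trace C T F) where
  simplicial := by
    intro G hG
    obtain ⟨S, hS, hd, rfl⟩ := mem_trace.1 hG
    obtain ⟨v, hv, h, -⟩ := hT.exists_vertex_of_dim_inf hS hF hd
    rw [h]
    exact isSimplicial_oppFacet (hT.simplicial S hS) v
  dim_eq := by
    intro G hG
    obtain ⟨S, hS, hd, rfl⟩ := mem_trace.1 hG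
    have := hF.2
    omega
  iUnion_eq := by
    classical
    refine Set.Subset.antisymm (Set.iUnion₂_subset fun G hG => ?_) fun y hy => ?_
    · obtain ⟨S, hS, hd, rfl⟩ := mem_trace.1 hG
      exact fun x hx => hx.2
    -- `W` collects the spans of the intersections `S ⊓ F` of too small dimension; none contains
    -- `F`, so some `x ∈ F` avoids them all. Moving from `y` towards `x` selects a cone `S`, and if
    -- `S ⊓ F` were too small, its span would contain `x`.
    · set W : Finset (Submodule ℝ (E n)) :=
        (T.filter fun S => dim (S ⊓ F) + 1 ≠ dim C).image
          fun S => Submodule.span ℝ ((S ⊓ F : PointedCone ℝ (E n)) : Set (E n)) with hW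
      obtain ⟨x, hx, hxW⟩ := exists_mem_forall_notMem (F := F) W (by
        simp only [hW, Finset.mem_image, Finset.mem_filter]
        rintro _ ⟨S, ⟨hS, hd⟩, rfl⟩
        by_contra! hcon
        have hle : Submodule.span ℝ (F : Set (E n)) ≤
            Submodule.span ℝ ((S ⊓ F : PointedCone ℝ (E n)) : Set (E n)) :=
          Submodule.span_le.2 fun f hf => hcon f hf
        have h1 : dim F ≤ dim (S ⊓ F) := Submodule.finrank_mono hle
        have h2 : dim (S ⊓ F) ≤ dim F := dim_mono inf_le_right
        have h3 := hF.2
        omega)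
      obtain ⟨S, hS, hyS, t, ht, htS⟩ := hT.exists_mem_add_smul_mem (hF.1.le hy) (hF.1.le hx)
      by_cases hd : dim (S ⊓ F) + 1 = dim C
      · exact Set.mem_biUnion (mem_trace.2 ⟨S, hS, hd, rfl⟩) ⟨hyS, hy⟩
      · exfalso
        refine hxW _ (Finset.mem_image_of_mem _ (Finset.mem_filter.2 ⟨hS, hd⟩)) ?_
        have h1 : y ∈ Submodule.span ℝ ((S ⊓ F : PointedCone ℝ (E n)) : Set (E n)) :=
          Submodule.subset_span ⟨hyS, hy⟩
        have h2 : y + t • x ∈ Submodule.span ℝ ((S ⊓ F : PointedCone ℝ (E n)) : Set (E n)) :=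
          Submodule.subset_span ⟨htS, F.add_mem hy (PointedCone.smul_mem _ ht.le hx)⟩
        exact (Submodule.smul_mem_iff _ ht.ne').1 ((Submodule.add_mem_iff_right _ h1).1 h2)
  inter_face := by
    intro G hG G' hG'
    obtain ⟨S, hS, hd, rfl⟩ := mem_trace.1 hG
    obtain ⟨S', hS', hd', rfl⟩ := mem_trace.1 hG'
    have h := hT.inter_face S hS S' hS'
    rw [← inf_inf_distrib_right]
    exact ⟨h.1.inf .rfl, h.2.inf .rfl⟩
  vertices_subset := by
    intro G hG v hv
    obtain ⟨S, hS, hd, rfl⟩ := mem_trace.1 hG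
    have hs := hT.simplicial S hS
    have hface : (S ⊓ F).IsFaceOf S := inf_isFaceOf_of_le hF.1 (hT.le hS)
    have hv' := (mem_vertices (fg_of_isFaceOf (fg_of_isSimplicial hs) hface)).1 hv
    have hvS : v ∈ vertices S :=
      (mem_vertices (fg_of_isSimplicial hs)).2 ⟨hv'.1, hv'.2.trans hface⟩
    have hvC := (mem_vertices hC).1 (hT.vertices_subset S hS hvS)
    exact (mem_vertices (fg_of_isFaceOf hC hF.1)).2
      ⟨hv'.1, (hvC.2.isFaceOf_iff_le hF.1).2 (hv'.2.le.trans inf_le_right)⟩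

end IsTriangulation

/-! ### Cancellation of interior facets and the facet recursion -/

open Classical in
/-- The contribution of a cone `G` to an adjoint polynomial with vertices from `C`. -/
noncomputable def adjTerm (C G : PointedCone ℝ (E n)) : MvPolynomial (Fin n) ℝ :=
  MvPolynomial.C (paraVol G) * ∏ v ∈ vertices C \ vertices G, linForm v

-- `V(C) \ V(G)` is the disjoint union of `V(C) \ V(F)` and `V(F) \ V(G)`, so the extra product in
-- `facetSum` turns each term into one that no longer involves `F`.
open Classical in
theorem adj_mul_prod {C F : PointedCone ℝ (E n)} {T : Finset (PointedCone ℝ (E n))}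
    (hT : IsTriangulation F T) (hFC : vertices F ⊆ vertices C) :
    adj F T * ∏ v ∈ vertices C \ vertices F, linForm v = ∑ G ∈ T, adjTerm C G := by
  rw [adj, Finset.sum_mul]
  refine Finset.sum_congr rfl fun G hG => ?_
  rw [adjTerm, mul_assoc, mul_comm (∏ v ∈ _, linForm v),
    ← Finset.sdiff_union_sdiff_cancel hFC (hT.vertices_subset G hG), Finset.prod_union]
  exact Finset.disjoint_left.2 fun v hv hv' =>
    (Finset.mem_sdiff.1 hv).2 (Finset.mem_sdiff.1 hv').1

theorem vertices_subset_of_isFaceOf {C F : PointedCone ℝ (E n)} (hC : C.FG) (hF : F.IsFaceOf C) :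
    vertices F ⊆ vertices C := fun v hv => by
  have h := (mem_vertices (fg_of_isFaceOf hC hF)).1 hv
  exact (mem_vertices hC).2 ⟨h.1, h.2.trans hF⟩

namespace IsTriangulation

variable {C : PointedCone ℝ (E n)} {T : Finset (PointedCone ℝ (E n))}

/-- The interior facets of a triangulation cancel in pairs. -/
theorem sum_interior_eq_zero (hT : IsTriangulation C T) (u : E n)
    [DecidablePred fun p : (_ : PointedCone ℝ (E n)) × E n =>
      ∀ y ∈ C, 0 ≤ inner ℝ (oppNormal p.1 p.2) y] :
    ∑ p ∈ (T.sigma fun S => vertices S).filter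
        (fun p => ¬ ∀ y ∈ C, 0 ≤ inner ℝ (oppNormal p.1 p.2) y),
      MvPolynomial.C (inner ℝ u (oppNormal p.1 p.2)) * adjTerm C (oppFacet p.1 p.2) = 0 := by
  have hopp : ∀ p ∈ (T.sigma fun S => vertices S).filter
      (fun p => ¬ ∀ y ∈ C, 0 ≤ inner ℝ (oppNormal p.1 p.2) y),
      ∃ q ∈ (T.sigma fun S => vertices S).filter
        (fun p => ¬ ∀ y ∈ C, 0 ≤ inner ℝ (oppNormal p.1 p.2) y),
        oppFacet q.1 q.2 = oppFacet p.1 p.2 ∧ oppNormal q.1 q.2 = -oppNormal p.1 p.2 := by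
    rintro ⟨S, v⟩ hp
    simp only [Finset.mem_filter, Finset.mem_sigma] at hp
    obtain ⟨⟨hS, hv⟩, hneg⟩ := hp
    push Not at hneg
    obtain ⟨z, hz, hneg⟩ := hneg
    obtain ⟨S', hS', v', hv', hG, hn⟩ := hT.exists_opposite hS hv hz hneg
    refine ⟨⟨S', v'⟩, ?_, hG, hn⟩
    simp only [Finset.mem_filter, Finset.mem_sigma]
    -- The partner is again interior: `v` itself lies on the negative side of its normal.
    refine ⟨⟨hS', hv'⟩, fun hcon => ?_⟩
    have hs := hT.simplicial S hS
    have h1 := hcon v (hT.le hS (mem_of_mem_vertices hs hv))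
    rw [hn, inner_neg_left] at h1
    linarith [inner_oppNormal_pos hs hv]
  choose g hg hgF hgn using hopp
  refine Finset.sum_involution g (fun p hp => ?_) (fun p hp _ heq => ?_) hg fun p hp => ?_
  · rw [hgF, hgn, inner_neg_right, map_neg]
    ring
  · have hp' := (Finset.mem_sigma.1 (Finset.mem_filter.1 hp).1)
    have h := hgn p hp
    rw [heq] at h
    have hpos := inner_oppNormal_pos (hT.simplicial _ hp'.1) hp'.2
    have h' := congrArg (fun m : E n => inner ℝ m p.2) h
    simp only [inner_neg_left] at h'
    linarith
  -- Passing to the partner twice restores the facet and its normal, which together determine the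
  -- cone and the vertex.
  · have hp' := (Finset.mem_sigma.1 (Finset.mem_filter.1 hp).1)
    have hq := (Finset.mem_sigma.1 (Finset.mem_filter.1 (hg _ (hg p hp))).1)
    have h := hT.eq_of_oppFacet_eq hq.1 hp'.1 hq.2 hp'.2 ((hgF _ (hg p hp)).trans (hgF p hp))
      (by rw [hgn _ (hg p hp), hgn p hp, neg_neg])
    exact Sigma.ext h.1 (heq_of_eq h.2)

/-- The boundary facets of a cone of a triangulation correspond to the facets of `C` it meets in
codimension one. -/
theorem sum_boundary (hC : C.FG) (hT : IsTriangulation C T) {S : PointedCone ℝ (E n)} (hS : S ∈ T)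
    (u : E n) [DecidablePred fun v : E n => ∀ y ∈ C, 0 ≤ inner ℝ (oppNormal S v) y] :
    ∑ v ∈ (vertices S).filter (fun v => ∀ y ∈ C, 0 ≤ inner ℝ (oppNormal S v) y),
      MvPolynomial.C (inner ℝ u (oppNormal S v)) * adjTerm C (oppFacet S v) =
    ∑ F ∈ (facets C).filter (fun F => dim (S ⊓ F) + 1 = dim C),
      MvPolynomial.C (inner ℝ u (inwardNormal C F)) * adjTerm C (S ⊓ F) := by
  have hs := hT.simplicial S hS
  refine Finset.sum_bij (fun v _ => orthFace C (oppNormal S v)) (fun v hv => ?_)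
    (fun v hv w hw h => ?_) (fun F hF => ?_) fun v hv => ?_
  · obtain ⟨hv, hpos⟩ := Finset.mem_filter.1 hv
    obtain ⟨h1, -, h3⟩ := hT.boundary_spec hS hv hpos
    refine Finset.mem_filter.2 ⟨(mem_facets hC).2 h1, ?_⟩
    rw [h3, (isFacet_oppFacet hs hv).2, hT.dim_eq S hS]
  · obtain ⟨hv, hvpos⟩ := Finset.mem_filter.1 hv
    obtain ⟨hw, hwpos⟩ := Finset.mem_filter.1 hw
    have hn : oppNormal S v = oppNormal S w := by
      rw [← (hT.boundary_spec hS hv hvpos).2.1, h, (hT.boundary_spec hS hw hwpos).2.1]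
    by_contra hne
    have h1 := inner_oppNormal_pos hs hv
    rw [hn, inner_oppNormal_of_ne hs hw hv hne] at h1
    exact lt_irrefl _ h1
  · obtain ⟨hF, hd⟩ := Finset.mem_filter.1 hF
    have hF := (mem_facets hC).1 hF
    obtain ⟨v, hv, -, hn⟩ := hT.exists_vertex_of_dim_inf hS hF hd
    refine ⟨v, Finset.mem_filter.2 ⟨hv, ?_⟩, ?_⟩
    · rw [hn]
      exact (inwardNormal_spec hF).2.2.2
    · rw [hn, ← eq_orthFace hF]
  · obtain ⟨hv, hpos⟩ := Finset.mem_filter.1 hv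
    obtain ⟨-, h2, h3⟩ := hT.boundary_spec hS hv hpos
    rw [h2, h3]

/-- No two cones have the same trace of codimension one: both would lie on the inner side of `F`
along a common facet. So the image defining `trace` loses no multiplicity. -/
theorem sum_trace (hT : IsTriangulation C T) {F : PointedCone ℝ (E n)} (hF : IsFacet C F)
    (φ : PointedCone ℝ (E n) → MvPolynomial (Fin n) ℝ) :
    ∑ G ∈ trace C T F, φ G =
      ∑ S ∈ T.filter (fun S => dim (S ⊓ F) + 1 = dim C), φ (S ⊓ F) := by
  classical
  rw [trace, Finset.sum_image]
  intro S hS S' hS' h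
  obtain ⟨hS, hd⟩ := Finset.mem_filter.1 hS
  obtain ⟨hS', hd'⟩ := Finset.mem_filter.1 hS'
  obtain ⟨v, hv, hG, hn⟩ := hT.exists_vertex_of_dim_inf hS hF hd
  obtain ⟨v', hv', hG', hn'⟩ := hT.exists_vertex_of_dim_inf hS' hF hd'
  exact (hT.eq_of_oppFacet_eq hS hS' hv hv' (by rw [← hG, ← hG']; exact h)
    (hn.trans hn'.symm)).1

/-- The facet recursion, for the triangulations of the facets induced by the one of `C`. -/
theorem linForm_mul_adj (hC : C.FG) (hT : IsTriangulation C T) {u : E n}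
    (hu : u ∈ Submodule.span ℝ (C : Set (E n))) :
    linForm u * adj C T = facetSum C (trace C T) u := by
  classical
  have hright : facetSum C (trace C T) u = ∑ F ∈ facets C,
      ∑ S ∈ T.filter (fun S => dim (S ⊓ F) + 1 = dim C),
        MvPolynomial.C (inner ℝ u (inwardNormal C F)) * adjTerm C (S ⊓ F) := by
    rw [facetSum]
    refine Finset.sum_congr rfl fun F hF => ?_
    have hF := (mem_facets hC).1 hF
    rw [mul_assoc, adj_mul_prod (hT.isTriangulation_trace hC hF)
      (vertices_subset_of_isFaceOf hC hF.1), hT.sum_trace hF, Finset.mul_sum]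
  have hleft : linForm u * adj C T = ∑ S ∈ T, ∑ v ∈ vertices S,
      MvPolynomial.C (inner ℝ u (oppNormal S v)) * adjTerm C (oppFacet S v) := by
    rw [adj, Finset.mul_sum]
    refine Finset.sum_congr rfl fun S hS => ?_
    have hs := hT.simplicial S hS
    rw [← mul_assoc, linForm_mul_paraVol hs (by rwa [hT.span_eq hS]), Finset.sum_mul]
    refine Finset.sum_congr rfl fun v hv => ?_
    have hvS : v ∉ vertices C \ vertices S := fun h => (Finset.mem_sdiff.1 h).2 hv
    -- Removing `v` from `V(S)` adds it to the complement in `V(C)`, which absorbs the factor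
    -- `linForm v`.
    rw [adjTerm, vertices_oppFacet hs, Finset.sdiff_erase (hT.vertices_subset S hS hv),
      Finset.prod_insert hvS, map_mul]
    ring
  have hbd : ∑ p ∈ (T.sigma fun S => vertices S).filter
        (fun p => ∀ y ∈ C, 0 ≤ inner ℝ (oppNormal p.1 p.2) y),
      MvPolynomial.C (inner ℝ u (oppNormal p.1 p.2)) * adjTerm C (oppFacet p.1 p.2) =
      ∑ S ∈ T, ∑ v ∈ (vertices S).filter (fun v => ∀ y ∈ C, 0 ≤ inner ℝ (oppNormal S v) y),
        MvPolynomial.C (inner ℝ u (oppNormal S v)) * adjTerm C (oppFacet S v) := by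
    rw [Finset.sum_filter, Finset.sum_sigma]
    simp only [Finset.sum_filter]
  rw [hleft, Finset.sum_sigma', ← Finset.sum_filter_add_sum_filter_not _
    (fun p => ∀ y ∈ C, 0 ≤ inner ℝ (oppNormal p.1 p.2) y), hT.sum_interior_eq_zero u, add_zero,
    hbd, hright, Finset.sum_congr rfl fun S hS => hT.sum_boundary hC hS u]
  simp only [Finset.sum_filter]
  exact Finset.sum_comm

theorem nonempty (hT : IsTriangulation C T) : T.Nonempty := by
  obtain ⟨S, hS, -⟩ := hT.exists_mem C.zero_mem
  exact ⟨S, hS⟩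

end IsTriangulation

/-! ### Independence of the triangulation -/

theorem linForm_ne_zero {u : E n} (hu : u ≠ 0) : linForm u ≠ 0 := by
  intro h
  refine hu ?_
  ext i
  have h' := congrArg (MvPolynomial.eval (Pi.single i (1 : ℝ))) h
  simpa [linForm, Pi.single_apply] using h'

theorem eq_bot_of_dim_eq_zero {C : PointedCone ℝ (E n)} (h : dim C = 0) : C = ⊥ := by
  have h' : Submodule.span ℝ (C : Set (E n)) = ⊥ := Submodule.finrank_eq_zero.1 h
  refine (Submodule.eq_bot_iff _).2 fun x hx => ?_
  have : x ∈ Submodule.span ℝ (C : Set (E n)) := Submodule.subset_span hx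
  rwa [h', Submodule.mem_bot] at this

/-- The adjoint polynomial does not depend on the triangulation. -/
theorem adj_eq_adj {C : PointedCone ℝ (E n)} (hC : C.FG) {T T' : Finset (PointedCone ℝ (E n))}
    (hT : IsTriangulation C T) (hT' : IsTriangulation C T') : adj C T = adj C T' := by
  induction hd : dim C generalizing C T T' with
  | zero =>
    have huniq : ∀ {T : Finset (PointedCone ℝ (E n))}, IsTriangulation C T → T = {⊥} :=
      fun {T} hT => Finset.eq_singleton_iff_nonempty_unique_mem.2
        ⟨hT.nonempty, fun S hS => eq_bot_of_dim_eq_zero ((hT.dim_eq S hS).trans hd)⟩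
    rw [huniq hT, huniq hT']
  | succ d ih =>
    obtain ⟨u, hu, hu0⟩ : ∃ u ∈ Submodule.span ℝ (C : Set (E n)), u ≠ 0 := by
      refine Submodule.exists_mem_ne_zero_of_ne_bot fun h => ?_
      rw [dim, h, finrank_bot] at hd
      exact absurd hd (Nat.succ_ne_zero d).symm
    -- The polynomial ring is a domain, so it suffices to compare the recursions, whose facets have
    -- dimension `d`.
    refine mul_left_cancel₀ (linForm_ne_zero hu0) ?_
    rw [hT.linForm_mul_adj hC hu, hT'.linForm_mul_adj hC hu, facetSum, facetSum]
    refine Finset.sum_congr rfl fun F hF => ?_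
    have hF := (mem_facets hC).1 hF
    rw [ih (fg_of_isFaceOf hC hF.1) (hT.isTriangulation_trace hC hF)
      (hT'.isTriangulation_trace hC hF) (by have := hF.2; omega)]

/-! ### Cones of dimension two -/

/-- A linear relation between irredundant generators of a salient cone has at least two negative
coefficients. -/
theorem one_lt_card_filter_neg {C : PointedCone ℝ (E n)}
    (hsal : (C : ConvexCone ℝ (E n)).Salient) {s t : Finset (E n)} [DecidableEq (E n)]
    (hsC : PointedCone.hull ℝ (s : Set (E n)) = C)
    (hirr : ∀ v ∈ s, v ∉ PointedCone.hull ℝ (s.erase v : Set (E n))) (hts : t ⊆ s)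
    {g : E n → ℝ} (hg : ∑ v ∈ t, g v • v = 0) {w : E n} (hw : w ∈ t) (hgw : g w ≠ 0) :
    1 < (t.filter fun v => g v < 0).card := by
  have hscale : ∀ x ∈ t, g x ≠ 0 → ∑ v ∈ t.erase x, (g v / g x) • v = -x := fun x hx hgx => by
    rw [← Finset.add_sum_erase _ _ hx] at hg
    have h1 : ∑ v ∈ t.erase x, (g v / g x) • v = (g x)⁻¹ • ∑ v ∈ t.erase x, g v • v := by
      rw [Finset.smul_sum]
      refine Finset.sum_congr rfl fun v _ => ?_
      rw [smul_smul, div_eq_inv_mul]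
    rw [h1, eq_neg_of_add_eq_zero_right hg, smul_neg, smul_smul, inv_mul_cancel₀ hgx, one_smul]
  by_contra hcard
  rcases (t.filter fun v => g v < 0).eq_empty_or_nonempty with hN | ⟨x, hx⟩
  -- Without negative coefficients, `-w` is a nonnegative combination of generators, contradicting
  -- salience.
  · have hnonneg : ∀ v ∈ t, 0 ≤ g v := fun v hv => not_lt.1 fun h =>
      Finset.notMem_empty v (hN ▸ Finset.mem_filter.2 ⟨hv, h⟩)
    have hw0 : w ≠ 0 := fun h => hirr w (hts hw) (h ▸ Submodule.zero_mem _)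
    have hsub : ∀ v ∈ t, v ∈ C := fun v hv => hsC ▸ Submodule.subset_span (hts hv)
    refine hsal w (hsub w hw) hw0 ?_
    rw [← hscale w hw hgw]
    exact Submodule.sum_mem C fun v hv => PointedCone.smul_mem C
      (div_nonneg (hnonneg v (Finset.mem_of_mem_erase hv)) (hnonneg w hw))
      (hsub v (Finset.mem_of_mem_erase hv))
  -- If `x` alone has a negative coefficient, it is a nonnegative combination of the others,
  -- contradicting irredundancy.
  · obtain ⟨hxt, hgx⟩ := Finset.mem_filter.1 hx
    have hnonneg : ∀ v ∈ t.erase x, 0 ≤ g v := fun v hv => not_lt.1 fun h =>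
      Finset.ne_of_mem_erase hv (Finset.card_le_one.1 (not_lt.1 hcard) v
        (Finset.mem_filter.2 ⟨Finset.mem_of_mem_erase hv, h⟩) x hx)
    refine hirr x (hts hxt) ?_
    have hxsum : x = ∑ v ∈ t.erase x, (g v / -g x) • v := by
      simp only [div_neg, neg_smul, Finset.sum_neg_distrib]
      rw [hscale x hxt hgx.ne, neg_neg]
    rw [hxsum]
    refine Submodule.sum_mem _ fun v hv => PointedCone.smul_mem _
      (div_nonneg (hnonneg v hv) (by linarith)) (Submodule.subset_span ?_)
    rw [← hxsum]
    exact Finset.erase_subset_erase x hts hv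

/-- A finitely generated salient cone of dimension two is simplicial. -/
theorem isSimplicial_of_dim_eq_two {C : PointedCone ℝ (E n)} (hC : C.FG)
    (hsal : (C : ConvexCone ℝ (E n)).Salient) (hd : dim C = 2) : C.IsSimplicial := by
  classical
  obtain ⟨s₀, hs₀⟩ := hC
  obtain ⟨s, -, hs⟩ := exists_minimal_le_of_wellFoundedLT
    (fun s : Finset (E n) => PointedCone.hull ℝ (s : Set (E n)) = C) s₀ hs₀
  have hsC : PointedCone.hull ℝ (s : Set (E n)) = C := hs.prop
  have hirr : ∀ v ∈ s, v ∉ PointedCone.hull ℝ (s.erase v : Set (E n)) := fun v hv hmem => by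
    have h : PointedCone.hull ℝ (s.erase v : Set (E n)) = C := by
      rw [← hsC]
      refine le_antisymm (Submodule.span_mono (by exact_mod_cast Finset.erase_subset v s))
        (Submodule.span_le.2 fun w hw => ?_)
      by_cases hwv : w = v
      · rwa [hwv]
      · exact Submodule.subset_span (Finset.mem_coe.2 (Finset.mem_erase.2 ⟨hwv, hw⟩))
    exact Finset.notMem_erase v s (hs.le_of_le h (Finset.erase_subset v s) hv)
  have hspan : Module.finrank ℝ (Submodule.span ℝ (s : Set (E n))) = 2 := by
    rw [← span_hull, hsC]
    exact hd
  have hcard : s.card ≤ 2 := by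
    by_contra hcon
    obtain ⟨t, hts, ht⟩ := Finset.exists_subset_card_eq (show 3 ≤ s.card by omega)
    have hdep : ¬ LinearIndepOn ℝ id (t : Set (E n)) := fun hli => by
      have h1 := finrank_span_finset_eq_card hli
      have h2 := Submodule.finrank_mono (R := ℝ) (Submodule.span_mono (R := ℝ)
        (show (t : Set (E n)) ⊆ s from by exact_mod_cast hts))
      omega
    rw [linearIndepOn_finset_iff] at hdep
    push Not at hdep
    obtain ⟨g, hg, w, hw, hgw⟩ := hdep
    -- Applied to the relation and to its negative, this demands two negative and two positive
    -- coefficients among three generators.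
    have hneg := one_lt_card_filter_neg hsal hsC hirr hts hg hw hgw
    have hpos := one_lt_card_filter_neg hsal hsC hirr hts (g := fun v => -g v)
      (by simpa using hg) hw (neg_ne_zero.2 hgw)
    have hdisj : Disjoint (t.filter fun v => g v < 0) (t.filter fun v => -g v < 0) :=
      Finset.disjoint_left.2 fun v hv hv' => by
        have h1 := (Finset.mem_filter.1 hv).2
        have h2 := (Finset.mem_filter.1 hv').2
        linarith
    have hle := Finset.card_le_card (Finset.union_subset
      (Finset.filter_subset (fun v => g v < 0) t) (Finset.filter_subset (fun v => -g v < 0) t))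
    rw [Finset.card_union_of_disjoint hdisj] at hle
    omega
  refine ⟨s, s.finite_toSet, ?_, hsC⟩
  refine linearIndependent_iff_card_le_finrank_span.2 ?_
  rw [Set.finrank, show Set.range (fun x : (s : Set (E n)) => id (x : E n)) = s from
    Subtype.range_coe, hspan]
  simpa using hcard

/-- A simplicial cone has as many vertices as its dimension. Each `S ∈ T` and `C` are simplicial of
equal dimension, so `V(S) ⊆ V(C)` is an equality. -/
theorem isTriangulation_iff_eq_singleton {C : PointedCone ℝ (E n)} (hC : C.FG)
    (hsal : (C : ConvexCone ℝ (E n)).Salient) (hd : dim C = 2)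
    {T : Finset (PointedCone ℝ (E n))} : IsTriangulation C T ↔ T = {C} := by
  have hs := isSimplicial_of_dim_eq_two hC hsal hd
  constructor
  · refine fun hT => Finset.eq_singleton_iff_nonempty_unique_mem.2 ⟨hT.nonempty, fun S hS => ?_⟩
    have hS' := hT.simplicial S hS
    have heq : vertices S = vertices C := by
      refine Finset.eq_of_subset_of_card_le (hT.vertices_subset S hS) ?_
      rw [← dim_eq_card_vertices hs, ← dim_eq_card_vertices hS', hT.dim_eq S hS]
    rw [← hull_vertices hS', heq, hull_vertices hs]
  · rintro rfl
    exact
      { simplicial := by simpa using hs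
        dim_eq := by simp
        iUnion_eq := by simp
        inter_face := by simp
        vertices_subset := by simp }

end ConeAdjoint

theorem corollary2p4 (n : ℕ) (C : PointedCone ℝ (EuclideanSpace ℝ (Fin n))) (hfg : C.FG)
    (hpointed : (C : ConvexCone ℝ (EuclideanSpace ℝ (Fin n))).Salient) :
    (∀ T T' : Finset (PointedCone ℝ (EuclideanSpace ℝ (Fin n))),
      ConeAdjoint.IsTriangulation C T → ConeAdjoint.IsTriangulation C T' →
        ConeAdjoint.adj C T = ConeAdjoint.adj C T') ∧
    (∀ (T : Finset (PointedCone ℝ (EuclideanSpace ℝ (Fin n))))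
      (τ : PointedCone ℝ (EuclideanSpace ℝ (Fin n)) →
        Finset (PointedCone ℝ (EuclideanSpace ℝ (Fin n)))),
      ConeAdjoint.IsTriangulation C T →
      (∀ F ∈ ConeAdjoint.facets C, ConeAdjoint.IsTriangulation F (τ F)) →
      ∀ u ∈ Submodule.span ℝ (C : Set (EuclideanSpace ℝ (Fin n))),
        ConeAdjoint.linForm u * ConeAdjoint.adj C T = ConeAdjoint.facetSum C τ u) ∧
    (ConeAdjoint.dim C = 2 →
      ∀ T : Finset (PointedCone ℝ (EuclideanSpace ℝ (Fin n))),
        ConeAdjoint.IsTriangulation C T ↔ T = {C}) := by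
  refine ⟨fun T T' hT hT' => ConeAdjoint.adj_eq_adj hfg hT hT', fun T τ hT hτ u hu => ?_,
    fun hd T => ConeAdjoint.isTriangulation_iff_eq_singleton hfg hpointed hd⟩
  -- The recursion holds for the induced triangulations; independence on each facet replaces them by
  -- `τ F`.
  rw [hT.linForm_mul_adj hfg hu, ConeAdjoint.facetSum, ConeAdjoint.facetSum]
  refine Finset.sum_congr rfl fun F hF => ?_
  have hF' := (ConeAdjoint.mem_facets hfg).1 hF
  rw [ConeAdjoint.adj_eq_adj (ConeAdjoint.fg_of_isFaceOf hfg hF'.1)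
    (hT.isTriangulation_trace hfg hF') (hτ F hF)]
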